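/- Let $\alpha>0$ and let $\Sigma=\{(x_1,0):x_1\in\mathbb R\}\subset\mathbb R^2$. Let $\Gamma\subset\mathbb R^2$ be a (Borel) compact deformation of $\Sigma$; that is: (a1) there is a compact set $M\subset\mathbb R^2$ with $\Gamma\setminus M=\Sigma\setminus M$; (a2) $\Gamma\setminus\Sigma=\bigcup_{i=1}^N\Gamma_i$ is a finite union ($0\le N<\infty$) of $C^1$ arcs of finite length without self-intersections and cusps. This means that $\Gamma_i=c_i(I_i)$ for an interval $I_i$ with $(0,L_i)\subset I_i\subset[0,L_i]$, $0<L_i<\infty$, where $c_i:I_i\to\mathbb R^2$ is continuous, is $C^1$ on $(0,L_i)$ with $|c_i'|=1$ there, and for some $C_i>0$ satisfies $|c_i(s)-c_i(s')|\ge C_i|s-s'|$ for all $s,s'\in I_i$. Let $\eta_\Gamma$ be the arc length measure on $\Gamma$ (the one-dimensional Hausdorff measure restricted to $\Gamma$), and let $-\Delta_\Gamma$ (formally $-\Delta-\alpha\,\delta(x-\Gamma)$) be the operator in $L^2(\mathbb R^2)$ associated with the quadratic form $$\gamma(f,g)=(\nabla f,\nabla g)_{L^2(\mathbb R^2)}-\alpha\,(I_\Gamma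 f,I_\Gamma g)_{L^2(\eta_\Gamma)},$$ where $f,g$ run over the Sobolev space of functions in $L^2(\mathbb R^2)$ with first-order weak derivatives in $L^2(\mathbb R^2)$, and $I_\Gamma$ is the embedding of this space into $L^2(\eta_\Gamma)$, the continuous extension of the restriction $\varphi\mapsto\varphi|_\Gamma$ of test functions. Let $-\Delta_\Sigma$ be the same operator for $\Gamma=\Sigma$. Then $-\Delta_\Gamma$ and $-\Delta_\Sigma$ are self-adjoint, and $$\sigma_{\rm ess}(-\Delta_\Gamma)=\sigma_{\rm ess}(-\Delta_\Sigma)=\left[-\tfrac14\alpha^2,\infty\right),$$ where $\sigma_{\rm ess}$ denotes the spectrum without the isolated eigenvalues of finite multiplicity. -/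

import Mathlib

open MeasureTheory Set
open scoped ContDiff InnerProductSpace MeasureTheory

noncomputable section

namespace LeakyWire

/-! ## Essential spectrum of an unbounded operator -/

section Spectrum

variable {H : Type*} [NormedAddCommGroup H] [InnerProductSpace ℂ H]

/-- `z` lies in the resolvent set of `T` if `T - z : dom T → H` is a bijection whose inverse is an
everywhere defined bounded operator `R`. -/
def resolventSet (T : H →ₗ.[ℂ] H) : Set ℂ :=
  {z | ∃ R : H →L[ℂ] H,
    (∀ h : H, ∃ hR : R h ∈ T.domain, T ⟨R h, hR⟩ - z • R h = h) ∧
    ∀ f : T.domain, R (T f - z • (f : H)) = f}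

/-- The spectrum of `T`. -/
def spectrum (T : H →ₗ.[ℂ] H) : Set ℂ := (resolventSet T)ᶜ

/-- The eigenspace `{f ∈ dom T | T f = z f}`. -/
def eigenspace (T : H →ₗ.[ℂ] H) (z : ℂ) : Submodule ℂ T.domain :=
  LinearMap.ker (T.toFun - z • T.domain.subtype)

/-- The discrete spectrum: isolated points of the spectrum that are eigenvalues of finite
multiplicity. -/
def discreteSpectrum (T : H →ₗ.[ℂ] H) : Set ℂ :=
  {z | z ∈ spectrum T ∧ (∃ ε > 0, spectrum T ∩ Metric.ball z ε = {z}) ∧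
    eigenspace T z ≠ ⊥ ∧ FiniteDimensional ℂ (eigenspace T z)}

/-- The essential spectrum (of a self-adjoint operator): what remains of the spectrum when the
isolated eigenvalues of finite multiplicity are removed. -/
def essentialSpectrum (T : H →ₗ.[ℂ] H) : Set ℂ := spectrum T \ discreteSpectrum T

end Spectrum

/-! ## Weak derivatives and traces -/

/-- The Euclidean plane. -/
abbrev Plane : Type := EuclideanSpace ℝ (Fin 2)

/-- The Hilbert space of square integrable complex functions on the plane. -/
abbrev L2 : Type := Lp ℂ 2 (volume : Measure Plane)

/-- Complex valued smooth functions of compact support. -/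
def IsTestFunction (φ : Plane → ℂ) : Prop := ContDiff ℝ ∞ φ ∧ HasCompactSupport φ

/-- The `i`-th partial derivative. -/
def partialDeriv (i : Fin 2) (φ : Plane → ℂ) (x : Plane) : ℂ :=
  fderiv ℝ φ x (EuclideanSpace.single i 1)

/-- `f ∈ L²` has the weak gradient `G ∈ L² × L²`; that is, `f` lies in the Sobolev space of
functions in `L²` with first order weak derivatives in `L²`, and `∇ f = G`. -/
def HasWeakGradient (f : L2) (G : Fin 2 → L2) : Prop :=
  ∀ i : Fin 2, ∀ φ : Plane → ℂ, IsTestFunction φ →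
    ∫ x, f x * partialDeriv i φ x = - ∫ x, G i x * φ x

/-- The triples `(φ, ∇ φ, φ|_η)` for test functions `φ`, where `φ|_η` is the class of `φ` in
`L²(η)`. -/
def restrictionGraph (η : Measure Plane) : Submodule ℂ (L2 × (Fin 2 → L2) × Lp ℂ 2 η) where
  carrier := {p | ∃ φ : Plane → ℂ, IsTestFunction φ ∧ p.1 =ᵐ[volume] φ ∧
    (∀ i, p.2.1 i =ᵐ[volume] partialDeriv i φ) ∧ p.2.2 =ᵐ[η] φ}
  zero_mem' := by
    refine ⟨0, ⟨contDiff_const, HasCompactSupport.zero⟩, ?_, fun i => ?_, ?_⟩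
    · exact Lp.coeFn_zero ..
    · refine (Lp.coeFn_zero ..).trans (Filter.Eventually.of_forall fun x => ?_)
      simp [partialDeriv]
    · exact Lp.coeFn_zero ..
  add_mem' := by
    rintro p q ⟨φ, hφ, h1, h2, h3⟩ ⟨ψ, hψ, k1, k2, k3⟩
    refine ⟨φ + ψ, ⟨hφ.1.add hψ.1, hφ.2.add hψ.2⟩, ?_, fun i => ?_, ?_⟩
    · exact (Lp.coeFn_add ..).trans (h1.add k1)
    · refine (Lp.coeFn_add ..).trans (((h2 i).add (k2 i)).trans
        (Filter.Eventually.of_forall fun x => ?_))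
      simp only [partialDeriv, Pi.add_apply]
      rw [fderiv_add (hφ.1.differentiable (by simp) x) (hψ.1.differentiable (by simp) x)]
      rfl
    · exact (Lp.coeFn_add ..).trans (h3.add k3)
  smul_mem' := by
    rintro c p ⟨φ, hφ, h1, h2, h3⟩
    refine ⟨c • φ, ⟨contDiff_const.smul hφ.1, hφ.2.smul_left⟩, ?_, fun i => ?_, ?_⟩
    · exact (Lp.coeFn_smul ..).trans (h1.const_smul c)
    · refine (Lp.coeFn_smul ..).trans (((h2 i).const_smul c).trans
        (Filter.Eventually.of_forall fun x => ?_))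
      simp only [partialDeriv, Pi.smul_apply]
      rw [fderiv_const_smul (hφ.1.differentiable (by simp) x)]
      rfl
    · exact (Lp.coeFn_smul ..).trans (h3.const_smul c)

/-- `u ∈ L²(η)` is the trace on `η` of the Sobolev function `f` with gradient `G`: there are test
functions `φₙ` with `φₙ → f` and `∇ φₙ → G` in `L²` (convergence in the Sobolev norm) and
`φₙ|_η → u` in `L²(η)`. This is the graph of the embedding of the Sobolev space into `L²(η)`
obtained by continuous extension from test functions. -/
def HasTrace (η : Measure Plane) (f : L2) (G : Fin 2 → L2) (u : Lp ℂ 2 η) : Prop :=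
  (f, G, u) ∈ (restrictionGraph η).topologicalClosure

/-! ## The operator defined by the quadratic form -/

/-- `∑ i, (∂ᵢ g, ∂ᵢ f) - α (v, u)_{L²(η)}`, where `G = ∇ f`, `K = ∇ g` and `u`, `v` are the traces
of `f`, `g`; the scalar products are conjugate linear in the first argument, i.e. in `g`. -/
def formValue (α : ℝ) {η : Measure Plane} (K : Fin 2 → L2) (v : Lp ℂ 2 η)
    (G : Fin 2 → L2) (u : Lp ℂ 2 η) : ℂ :=
  ∑ i, ⟪K i, G i⟫_ℂ - (α : ℂ) * ⟪v, u⟫_ℂ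

theorem integrable_mul_test (f : L2) {φ : Plane → ℂ} (hc : Continuous φ)
    (hs : HasCompactSupport φ) : Integrable (fun x => f x * φ x) :=
  have hφ : MemLp φ 2 (volume : Measure Plane) := hc.memLp_of_hasCompactSupport hs
  (Lp.memLp f).integrable_mul hφ

theorem IsTestFunction.continuous_partialDeriv {φ : Plane → ℂ} (h : IsTestFunction φ) (i : Fin 2) :
    Continuous (partialDeriv i φ) :=
  (h.1.continuous_fderiv (by simp)).clm_apply continuous_const

theorem IsTestFunction.hasCompactSupport_partialDeriv {φ : Plane → ℂ} (h : IsTestFunction φ)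
    (i : Fin 2) : HasCompactSupport (partialDeriv i φ) :=
  h.2.fderiv_apply ℝ (EuclideanSpace.single i 1)

theorem HasWeakGradient.add {f g : L2} {F G : Fin 2 → L2} (hf : HasWeakGradient f F)
    (hg : HasWeakGradient g G) : HasWeakGradient (f + g) (F + G) := by
  intro i φ hφ
  have e1 : ∫ x, (f + g : L2) x * partialDeriv i φ x
      = ∫ x, (f x * partialDeriv i φ x + g x * partialDeriv i φ x) := by
    refine integral_congr_ae ?_
    filter_upwards [Lp.coeFn_add f g] with x hx
    rw [hx, Pi.add_apply, add_mul]
  have e2 : ∫ x, (F + G) i x * φ x = ∫ x, (F i x * φ x + G i x * φ x) := by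
    refine integral_congr_ae ?_
    filter_upwards [Lp.coeFn_add (F i) (G i)] with x hx
    rw [Pi.add_apply, hx, Pi.add_apply, add_mul]
  have hd := hφ.continuous_partialDeriv i
  have hs := hφ.hasCompactSupport_partialDeriv i
  rw [e1, e2, integral_add (integrable_mul_test f hd hs) (integrable_mul_test g hd hs),
    integral_add (integrable_mul_test (F i) hφ.1.continuous hφ.2)
      (integrable_mul_test (G i) hφ.1.continuous hφ.2), hf i φ hφ, hg i φ hφ, neg_add]

theorem HasWeakGradient.smul {f : L2} {F : Fin 2 → L2} (c : ℂ) (hf : HasWeakGradient f F) :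
    HasWeakGradient (c • f) (c • F) := by
  intro i φ hφ
  have e1 : ∫ x, (c • f : L2) x * partialDeriv i φ x = ∫ x, c * (f x * partialDeriv i φ x) := by
    refine integral_congr_ae ?_
    filter_upwards [Lp.coeFn_smul c f] with x hx
    rw [hx, Pi.smul_apply, smul_eq_mul, mul_assoc]
  have e2 : ∫ x, (c • F) i x * φ x = ∫ x, c * (F i x * φ x) := by
    refine integral_congr_ae ?_
    filter_upwards [Lp.coeFn_smul c (F i)] with x hx
    rw [Pi.smul_apply, hx, Pi.smul_apply, smul_eq_mul, mul_assoc]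
  rw [e1, e2, integral_const_mul, integral_const_mul, hf i φ hφ, mul_neg]

/-- The graph of the operator associated with the form: the pairs `(f, h)` such that `f` is in the
form domain and the form takes the value `(g, h)` at `(g, f)` for all `g` in the form domain. -/
def formGraph (α : ℝ) (η : Measure Plane) : Submodule ℂ (L2 × L2) where
  carrier := {p | ∃ (G : Fin 2 → L2) (u : Lp ℂ 2 η), HasWeakGradient p.1 G ∧ HasTrace η p.1 G u ∧
    ∀ (g : L2) (K : Fin 2 → L2) (v : Lp ℂ 2 η), HasWeakGradient g K → HasTrace η g K v →
      formValue α K v G u = ⟪g, p.2⟫_ℂ}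
  zero_mem' := by
    refine ⟨0, 0, fun i φ _ => ?_, Submodule.zero_mem _, fun g K v _ _ => ?_⟩
    · have e : ∀ ψ : Plane → ℂ, ∫ x, (0 : L2) x * ψ x = 0 := fun ψ => by
        refine integral_eq_zero_of_ae ?_
        filter_upwards [Lp.coeFn_zero ℂ 2 (volume : Measure Plane)] with x hx
        rw [hx]
        simp
      exact (e (partialDeriv i φ)).trans (neg_eq_zero.mpr (e φ)).symm
    · simp [formValue]
  add_mem' := by
    rintro p q ⟨G, u, h1, h2, h3⟩ ⟨G', u', k1, k2, k3⟩
    refine ⟨G + G', u + u', h1.add k1, Submodule.add_mem _ h2 k2, fun g K v hg hv => ?_⟩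
    have e1 := h3 g K v hg hv
    have e2 := k3 g K v hg hv
    rw [Prod.snd_add, inner_add_right, ← e1, ← e2]
    simp only [formValue, Pi.add_apply, inner_add_right, Finset.sum_add_distrib]
    ring
  smul_mem' := by
    rintro c p ⟨G, u, h1, h2, h3⟩
    refine ⟨c • G, c • u, h1.smul c, Submodule.smul_mem _ c h2, fun g K v hg hv => ?_⟩
    have e1 := h3 g K v hg hv
    rw [Prod.smul_snd, inner_smul_right, ← e1]
    simp only [formValue, Pi.smul_apply, inner_smul_right, ← Finset.mul_sum]
    ring

/-- The arc length measure on a subset of the plane: the one-dimensional Hausdorff measure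
restricted to it. -/
def arcMeasure (Γ : Set Plane) : Measure Plane := (μH[1] : Measure Plane).restrict Γ

/-- The Hamiltonian `-Δ - α δ(x - Γ)`: the operator in `L²` associated with the form
`(∇ f, ∇ g) - α (f, g)_{L²(Γ)}`. -/
def hamiltonian (α : ℝ) (Γ : Set Plane) : L2 →ₗ.[ℂ] L2 :=
  (formGraph α (arcMeasure Γ)).toLinearPMap

/-! ## The geometry -/

/-- The straight line `{(x₁, 0)}`. -/
def straightLine : Set Plane := {x | x 1 = 0}

/-- A `C¹` arc of finite length `L > 0`, with or without its endpoints, parametrized by arc length,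
without self-intersections and without cusps (the distance of two points of the arc is at least a
positive multiple of the length of the arc between them). -/
def IsC1Arc (A : Set Plane) : Prop :=
  ∃ (L : ℝ) (I : Set ℝ) (c : ℝ → Plane), 0 < L ∧ Ioo 0 L ⊆ I ∧ I ⊆ Icc 0 L ∧ A = c '' I ∧
    ContinuousOn c I ∧ ContDiffOn ℝ 1 c (Ioo 0 L) ∧ (∀ s ∈ Ioo 0 L, ‖deriv c s‖ = 1) ∧
    ∃ C > 0, ∀ s ∈ I, ∀ t ∈ I, C * |s - t| ≤ ‖c s - c t‖

/-- `Γ` is a compact deformation of the straight line: it coincides with the line outside a compact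
set, and the part of it off the line is a finite union of `C¹` arcs. -/
structure IsCompactDeformation (Γ : Set Plane) : Prop where
  measurableSet : MeasurableSet Γ
  eq_outside_compact : ∃ M : Set Plane, IsCompact M ∧ Γ \ M = straightLine \ M
  arcs : ∃ (N : ℕ) (A : Fin N → Set Plane), (∀ i, IsC1Arc (A i)) ∧ Γ \ straightLine = ⋃ i, A i

end LeakyWire

end

/-!
The operator `-Δ - α δ(x - Γ)` is self-adjoint with essential spectrum `[-α² / 4, ∞)` for every
compact deformation `Γ` of the straight line; the line itself is one.

The form domain is realized as the Hilbert space of triples of a function, its gradient and its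
trace. In this form the operator is `A f = J† h` for a bounded self-adjoint `A` and an injection `J`
of the form domain into `L²` (`IsFormOperator`), and self-adjointness and the location of the
essential spectrum reduce to two inequalities on test functions
(`isSelfAdjoint_and_essentialSpectrum_eq`).

* An inequality from below (`HasTraceBound`). On the line, `β |g(0)|² ≤ ∫ |g'|² + β² / 4 ∫ |g|²`
  holds on each normal, and integration over the normals gives the sharp trace inequality. The
  rest of `Γ` is bounded and its length measure has linear growth, `η (B(z, r)) ≤ K r`, because the
  arcs have no cusps. On a small square of side `h` the squared norm in `L²(η)` of the deviation of
  `f` from its mean value is therefore at most `O(h) ‖∇ f‖²`, and the finitely many mean values form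
  a finite rank perturbation. Hence for `c < -α² / 4` the form minus `c` is positive up to a finite rank form,
  and by the Fredholm alternative and an orthogonality count the spectrum below `c` consists of
  finitely many eigenvalues of finite multiplicity.

* Approximate eigenfunctions for `t = -α² / 4 + k²` (`HasWeylSequences`). The functions
  `χ(x₁) w(x₂)`, with `χ` a slowly modulated wave `exp (i k x₁)` supported far to the right of the
  deformation and `w` a smooth approximation of `exp (-α |x₂| / 2)`, do not see the deformation. The
  normal part of the form, shifted by `-α² / 4`, is positive on the line by the sharp trace
  inequality and nearly vanishes on these functions, so the Cauchy–Schwarz inequality bounds it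
  against all test functions; the tangential part is treated by an integration by parts. A Weyl
  criterion in the dual norm of the form domain (`exists_norm_le_of_mem_resolventSet`) concludes.
-/

/-! ### Operators defined by closed semibounded forms -/

namespace LeakyWire

open ContinuousLinearMap (adjoint)

/-- `T` is the operator in `H` associated with a closed form that is bounded below. The form domain
is the Hilbert space `V`, mapped into `H` by the injection `J` with dense range; the form is
`⟪g, A f⟫` with a bounded self-adjoint operator `A` on `V`. The operator takes the value `h` at
`J f` if `⟪g, A f⟫ = ⟪J g, h⟫` for all `g`, that is, if `A f = J† h`. -/
structure IsFormOperator {H V : Type*} [NormedAddCommGroup H] [InnerProductSpace ℂ H]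
    [CompleteSpace H] [NormedAddCommGroup V] [InnerProductSpace ℂ V] [CompleteSpace V]
    (A : V →L[ℂ] V) (J : V →L[ℂ] H) (T : H →ₗ.[ℂ] H) : Prop where
  symm : ∀ f g, ⟪A f, g⟫_ℂ = ⟪f, A g⟫_ℂ
  injective : Function.Injective J
  eq_zero_of_adjoint : ∀ h, adjoint J h = 0 → h = 0
  coercive : ∃ m δ : ℝ, 0 < δ ∧ ∀ f, δ * ‖f‖ ^ 2 ≤ (⟪A f, f⟫_ℂ).re + m * ‖J f‖ ^ 2
  mem_graph : ∀ x h, (x, h) ∈ T.graph ↔ ∃ f, J f = x ∧ A f = adjoint J h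

theorem units_apply_inv_apply {V : Type*} [NormedAddCommGroup V] [InnerProductSpace ℂ V]
    (u : (V →L[ℂ] V)ˣ) (f : V) :
    (u : V →L[ℂ] V) ((↑u⁻¹ : V →L[ℂ] V) f) = f := by
  change ((u : V →L[ℂ] V) * (↑u⁻¹ : V →L[ℂ] V)) f = f
  rw [u.mul_inv]
  rfl

theorem units_inv_apply_apply {V : Type*} [NormedAddCommGroup V] [InnerProductSpace ℂ V]
    (u : (V →L[ℂ] V)ˣ) (f : V) :
    (↑u⁻¹ : V →L[ℂ] V) ((u : V →L[ℂ] V) f) = f :=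
  units_apply_inv_apply u⁻¹ f

/-- A variant of the Lax–Milgram theorem: the form controls the norm of the form domain only after
the addition of a multiple of `‖J f‖ ^ 2`, which it controls separately. -/
theorem isUnit_of_form_bounds {H V : Type*} [NormedAddCommGroup H] [InnerProductSpace ℂ H]
    [NormedAddCommGroup V] [InnerProductSpace ℂ V] [CompleteSpace V]
    {B : V →L[ℂ] V} {J : V →L[ℂ] H} {δ p q : ℝ} (hδ : 0 < δ) (hp : 0 < p)
    (h1 : ∀ f, p * ‖J f‖ ^ 2 ≤ ‖⟪B f, f⟫_ℂ‖)
    (h2 : ∀ f, δ * ‖f‖ ^ 2 - q * ‖J f‖ ^ 2 ≤ ‖⟪B f, f⟫_ℂ‖) : IsUnit B := by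
  have hq : 0 < 1 + |q| / p := by positivity
  refine ContinuousLinearMap.isUnit_of_forall_le_norm_inner_map B
    (c := ⟨δ / (1 + |q| / p), by positivity⟩) (show 0 < δ / (1 + |q| / p) by positivity)
    fun f => ?_
  change ‖f‖ ^ 2 * (δ / (1 + |q| / p)) ≤ _
  rw [mul_div_assoc', div_le_iff₀ hq]
  have h3 : |q| * ‖J f‖ ^ 2 ≤ |q| / p * ‖⟪B f, f⟫_ℂ‖ := by
    rw [div_mul_eq_mul_div, le_div_iff₀ hp, mul_assoc]
    gcongr
    linarith [h1 f]
  have h4 : q * ‖J f‖ ^ 2 ≤ |q| * ‖J f‖ ^ 2 := by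
    gcongr
    exact le_abs_self q
  linarith [h2 f]

section FormOperator

variable {H V : Type*} [NormedAddCommGroup H] [InnerProductSpace ℂ H]
    [CompleteSpace H] [NormedAddCommGroup V] [InnerProductSpace ℂ V] [CompleteSpace V]

/-- The bounded operator on the form domain that represents the form shifted by `z`, i.e.
`⟪g, A f⟫ - z ⟪J g, J f⟫`. -/
noncomputable def shift (A : V →L[ℂ] V) (J : V →L[ℂ] H) (z : ℂ) : V →L[ℂ] V :=
  A - z • (adjoint J ∘L J)

theorem shift_apply (A : V →L[ℂ] V) (J : V →L[ℂ] H) (z : ℂ) (f : V) :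
    shift A J z f = A f - z • adjoint J (J f) := rfl

namespace IsFormOperator

variable {A : V →L[ℂ] V} {J : V →L[ℂ] H} {T : H →ₗ.[ℂ] H}

theorem im_inner (hT : IsFormOperator A J T) (f : V) : (⟪A f, f⟫_ℂ).im = 0 := by
  have h := inner_conj_symm (𝕜 := ℂ) f (A f)
  rw [hT.symm f f]
  rw [hT.symm f f] at h
  exact Complex.conj_eq_iff_im.1 h

theorem inner_shift (A : V →L[ℂ] V) (J : V →L[ℂ] H) (z : ℂ) (f : V) :
    ⟪shift A J z f, f⟫_ℂ = ⟪A f, f⟫_ℂ - (starRingEnd ℂ) z * (‖J f‖ ^ 2 : ℝ) := by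
  rw [shift_apply, inner_sub_left, inner_smul_left, ContinuousLinearMap.adjoint_inner_left,
    inner_self_eq_norm_sq_to_K]
  simp

theorem isUnit_shift_of_im_ne_zero (hT : IsFormOperator A J T) {z : ℂ} (hz : z.im ≠ 0) :
    IsUnit (shift A J z) := by
  obtain ⟨m, δ, hδ, hc⟩ := hT.coercive
  refine isUnit_of_form_bounds (J := J) (p := |z.im|) (q := m + z.re) hδ (abs_pos.2 hz)
    (fun f => ?_) fun f => ?_
  · refine le_trans ?_ (Complex.abs_im_le_norm _)
    rw [inner_shift, Complex.sub_im, hT.im_inner, Complex.mul_im, Complex.ofReal_re,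
      Complex.ofReal_im, Complex.conj_im, mul_zero, zero_add, zero_sub, neg_mul, neg_neg, abs_mul,
      abs_of_nonneg (sq_nonneg ‖J f‖)]
  · refine le_trans ?_ (Complex.re_le_norm _)
    rw [inner_shift, Complex.sub_re, Complex.mul_re]
    simp only [Complex.conj_re, Complex.ofReal_re, Complex.conj_im, Complex.ofReal_im]
    linarith [hc f]

theorem exists_isUnit_shift (hT : IsFormOperator A J T) :
    ∃ m : ℝ, IsUnit (shift A J (-m : ℝ)) ∧ ∃ δ > 0, ∀ f, δ * ‖f‖ ^ 2 ≤
      (⟪shift A J (-m : ℝ) f, f⟫_ℂ).re := by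
  obtain ⟨m, δ, hδ, hc⟩ := hT.coercive
  have key : ∀ f, δ * ‖f‖ ^ 2 ≤ (⟪shift A J (-m : ℝ) f, f⟫_ℂ).re := fun f => by
    rw [inner_shift, Complex.sub_re, Complex.mul_re]
    simp only [Complex.conj_re, Complex.ofReal_re, Complex.conj_im, Complex.ofReal_im]
    linarith [hc f]
  refine ⟨m, ?_, δ, hδ, key⟩
  exact ContinuousLinearMap.isUnit_of_forall_le_norm_inner_map _ (c := ⟨δ, hδ.le⟩) hδ fun f => by
    change ‖f‖ ^ 2 * δ ≤ _
    linarith [key f, Complex.re_le_norm (⟪shift A J (-m : ℝ) f, f⟫_ℂ)]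

theorem mem_graph_of_shift (hT : IsFormOperator A J T) {z : ℂ} {f : V} {h : H}
    (hf : shift A J z f = adjoint J h) : (J f, z • J f + h) ∈ T.graph := by
  rw [hT.mem_graph]
  refine ⟨f, rfl, ?_⟩
  rw [map_add, map_smul, ← hf, shift_apply]
  abel

theorem shift_of_mem_graph (hT : IsFormOperator A J T) {z : ℂ} {x k : H}
    (hx : (x, k) ∈ T.graph) : ∃ f, J f = x ∧ shift A J z f = adjoint J (k - z • x) := by
  obtain ⟨f, rfl, hf⟩ := (hT.mem_graph x k).1 hx
  exact ⟨f, rfl, by rw [shift_apply, hf, map_sub, map_smul]⟩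

/-- If the shifted form is represented by an invertible operator, then the resolvent is
`J (A - z J† J)⁻¹ J†`. -/
theorem mem_resolventSet_of_isUnit (hT : IsFormOperator A J T) {z : ℂ}
    (hz : IsUnit (shift A J z)) : z ∈ resolventSet T := by
  obtain ⟨u, hu⟩ := hz
  have hr : ∀ f, shift A J z ((↑u⁻¹ : V →L[ℂ] V) f) = f := fun f => by
    rw [← hu, units_apply_inv_apply]
  have hl : ∀ f, (↑u⁻¹ : V →L[ℂ] V) (shift A J z f) = f := fun f => by
    rw [← hu, units_inv_apply_apply]
  refine ⟨J ∘L (↑u⁻¹ : V →L[ℂ] V) ∘L adjoint J, fun h => ?_, fun f => ?_⟩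
  · have := hT.mem_graph_of_shift (hr (adjoint J h))
    obtain ⟨y, hy1, hy2⟩ := (T.mem_graph_iff).1 this
    have hd : J ((↑u⁻¹ : V →L[ℂ] V) (adjoint J h)) ∈ T.domain := by
      have := y.2
      rwa [hy1] at this
    refine ⟨hd, ?_⟩
    have : (⟨_, hd⟩ : T.domain) = y := Subtype.ext hy1.symm
    change T ⟨J ((↑u⁻¹ : V →L[ℂ] V) (adjoint J h)), hd⟩ -
      z • J ((↑u⁻¹ : V →L[ℂ] V) (adjoint J h)) = h
    rw [this, hy2]
    simp
  · obtain ⟨g, hg1, hg2⟩ := hT.shift_of_mem_graph (z := z) (T.mem_graph f)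
    change J ((↑u⁻¹ : V →L[ℂ] V) (adjoint J (T f - z • (f : H)))) = f
    rw [← hg2, hl, hg1]

/-- A point of the resolvent set admits no Weyl sequence, even if the approximate eigenvectors
are only taken from the form domain and the residual is measured in its dual norm. -/
theorem exists_norm_le_of_mem_resolventSet (hT : IsFormOperator A J T) {z : ℂ}
    (hz : z ∈ resolventSet T) : ∃ C, ∀ f, ‖J f‖ ≤ C * ‖shift A J z f‖ := by
  obtain ⟨R, -, hR⟩ := hz
  obtain ⟨m, ⟨u, hu⟩, -⟩ := hT.exists_isUnit_shift
  set S : V →L[ℂ] V := ↑u⁻¹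
  have hr : ∀ f, shift A J (-m : ℝ) (S f) = f := fun f => by
    rw [← hu]
    exact units_apply_inv_apply u f
  refine ⟨‖R‖ * (‖(m + z : ℂ)‖ * (‖J‖ * ‖S‖)) + ‖J‖ * ‖S‖, fun f => ?_⟩
  set r := shift A J z f
  -- The corrected vector `f - S r` has its image in the domain of the operator.
  have h1 : shift A J z (f - S r) = adjoint J ((m + z) • J (S r)) := by
    have e := hr r
    rw [shift_apply, sub_eq_iff_eq_add] at e
    rw [map_sub, shift_apply A J z (S r), e, map_smul]
    change r - _ = _
    push_cast
    module
  obtain ⟨y, hy1, hy2⟩ := (T.mem_graph_iff).1 (hT.mem_graph_of_shift h1)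
  have h2 : J (f - S r) = R ((m + z) • J (S r)) := by
    have := hR y
    rw [hy1, hy2] at this
    simpa using this.symm
  have h3 : ‖J (S r)‖ ≤ ‖J‖ * ‖S‖ * ‖r‖ := by
    rw [mul_assoc]
    exact (J.le_opNorm _).trans (by gcongr; exact S.le_opNorm _)
  have h4 : ‖J (f - S r)‖ ≤ ‖R‖ * (‖(m + z : ℂ)‖ * (‖J‖ * ‖S‖ * ‖r‖)) := by
    rw [h2]
    refine (R.le_opNorm _).trans ?_
    rw [norm_smul]
    gcongr
  calc ‖J f‖ = ‖J (f - S r) + J (S r)‖ := by rw [map_sub]; simp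
    _ ≤ ‖J (f - S r)‖ + ‖J (S r)‖ := norm_add_le _ _
    _ ≤ _ := by linarith

theorem inner_graph_symm (hT : IsFormOperator A J T) {x h y k : H} (hx : (x, h) ∈ T.graph)
    (hy : (y, k) ∈ T.graph) : ⟪h, y⟫_ℂ = ⟪x, k⟫_ℂ := by
  obtain ⟨f, rfl, hf⟩ := (hT.mem_graph _ _).1 hx
  obtain ⟨g, rfl, hg⟩ := (hT.mem_graph _ _).1 hy
  rw [← ContinuousLinearMap.adjoint_inner_left, ← hf, hT.symm, hg,
    ContinuousLinearMap.adjoint_inner_right]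

/-- The operator is symmetric, and `T + m` has a bounded inverse for large `m`, so the adjoint has
no larger domain. -/
theorem isSelfAdjoint (hT : IsFormOperator A J T) : IsSelfAdjoint T := by
  obtain ⟨m, ⟨u, hu⟩, δ, hδ, hc⟩ := hT.exists_isUnit_shift
  set S : V →L[ℂ] V := ↑u⁻¹
  have hr : ∀ f, shift A J (-m : ℝ) (S f) = f := fun f => by
    rw [← hu]
    exact units_apply_inv_apply u f
  have hgr : ∀ h, (J (S (adjoint J h)), ((-m : ℝ) : ℂ) • J (S (adjoint J h)) + h) ∈ T.graph :=
    fun h => hT.mem_graph_of_shift (hr _)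
  have hdom : Dense (T.domain : Set H) := by
    rw [Submodule.dense_iff_topologicalClosure_eq_top, Submodule.topologicalClosure_eq_top_iff,
      Submodule.eq_bot_iff]
    intro h hh
    obtain ⟨y, hy1, -⟩ := (T.mem_graph_iff).1 (hgr h)
    have h0 : ⟪J (S (adjoint J h)), h⟫_ℂ = 0 := hh _ (by have := y.2; rwa [hy1] at this)
    have h1 := hc (S (adjoint J h))
    rw [hr, ContinuousLinearMap.adjoint_inner_left, ← inner_conj_symm, h0] at h1
    simp only [map_zero, Complex.zero_re] at h1
    have h2 : S (adjoint J h) = 0 := by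
      have : ‖S (adjoint J h)‖ ^ 2 ≤ 0 := by nlinarith
      simpa using this
    refine hT.eq_zero_of_adjoint h ?_
    rw [← hr (adjoint J h), h2, map_zero]
  rw [LinearPMap.isSelfAdjoint_def]
  refine LinearPMap.eq_of_eq_graph ?_
  rw [LinearPMap.adjoint_graph_eq_graph_adjoint hdom]
  ext ⟨y, k⟩
  rw [Submodule.mem_adjoint_iff]
  refine ⟨fun H => ?_, fun H a b hab => ?_⟩
  · have key : y = J (S (adjoint J (k + (m : ℂ) • y))) := by
      refine ext_inner_left ℂ fun h => ?_
      have e1 := H _ _ (hgr h)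
      have e2 := hT.inner_graph_symm (hgr h) (hgr (k + (m : ℂ) • y))
      simp only [inner_add_left, inner_add_right, inner_smul_left, inner_smul_right,
        Complex.conj_ofReal] at e1 e2
      push_cast at e1 e2
      linear_combination e1 - e2
    have := hgr (k + (m : ℂ) • y)
    rw [← key] at this
    convert! this using 2
    push_cast
    module
  · simp only
    rw [hT.inner_graph_symm hab H, sub_self]

theorem spectrum_im (hT : IsFormOperator A J T) {z : ℂ} (hz : z ∈ spectrum T) : z.im = 0 := by
  by_contra h
  exact hz (hT.mem_resolventSet_of_isUnit (hT.isUnit_shift_of_im_ne_zero h))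

/-- Below a level at which the form becomes bounded after adding a finite rank form, every point
of the spectrum is an eigenvalue (by the Fredholm alternative). -/
theorem exists_eigenvector (hT : IsFormOperator A J T) {c C : ℝ} (hC : 0 ≤ C) {E : Submodule ℂ H}
    [FiniteDimensional ℂ E]
    (hE : ∀ f, c * ‖J f‖ ^ 2 ≤ (⟪A f, f⟫_ℂ).re + C * ‖E.starProjection (J f)‖ ^ 2)
    {t : ℝ} (ht : t < c) (hs : (t : ℂ) ∈ spectrum T) :
    ∃ x, x ≠ 0 ∧ (x, (t : ℂ) • x) ∈ T.graph := by
  obtain ⟨m, δ, hδ, hc⟩ := hT.coercive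
  set F : V →L[ℂ] V := (C : ℂ) • (adjoint J ∘L E.starProjection ∘L J)
  have hF : IsCompactOperator F := by
    have h1 : IsCompactOperator E.starProjection := by
      have : ProperSpace E := FiniteDimensional.proper ℂ E
      have : IsCompactOperator E.orthogonalProjectionOnto :=
        isCompactOperator_of_locallyCompactSpace_dom E.orthogonalProjectionOnto
      exact this.clm_comp E.subtypeL
    exact ((h1.comp_clm J).clm_comp (adjoint J)).smul (C : ℂ)
  have hFi : ∀ f, ⟪F f, f⟫_ℂ = (C * ‖E.starProjection (J f)‖ ^ 2 : ℝ) := fun f => by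
    change ⟪(C : ℂ) • adjoint J (E.starProjection (J f)), f⟫_ℂ = _
    rw [inner_smul_left, ContinuousLinearMap.adjoint_inner_left, Complex.conj_ofReal,
      ← Submodule.starProjection_eq_self_iff.2 (E.starProjection_apply_mem (J f)),
      Submodule.inner_starProjection_left_eq_right, Submodule.starProjection_eq_self_iff.2
        (E.starProjection_apply_mem (J f)), inner_self_eq_norm_sq_to_K]
    push_cast
    rfl
  have hre : ∀ f, (⟪(shift A J t + F) f, f⟫_ℂ).re =
      (⟪A f, f⟫_ℂ).re - t * ‖J f‖ ^ 2 + C * ‖E.starProjection (J f)‖ ^ 2 := fun f => by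
    rw [add_apply, inner_add_left, inner_shift, hFi, Complex.conj_ofReal,
      ← Complex.ofReal_mul, Complex.add_re, Complex.sub_re, Complex.ofReal_re, Complex.ofReal_re]
  obtain ⟨u, hu⟩ : IsUnit (shift A J t + F) := by
    refine isUnit_of_form_bounds (J := J) (p := c - t) (q := m + t) hδ (sub_pos.2 ht)
      (fun f => ?_) fun f => ?_
    · refine le_trans ?_ (Complex.re_le_norm _)
      rw [hre]
      linarith [hE f]
    · refine le_trans ?_ (Complex.re_le_norm _)
      rw [hre]
      have : 0 ≤ C * ‖E.starProjection (J f)‖ ^ 2 := by positivity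
      linarith [hc f]
  set K : V →L[ℂ] V := (↑u⁻¹ : V →L[ℂ] V) ∘L F
  have hK : IsCompactOperator K := hF.clm_comp _
  rcases hK.hasEigenvalue_or_mem_resolventSet one_ne_zero with h | h
  · obtain ⟨f, hf⟩ := h.exists_hasEigenvector
    have h1 : (↑u⁻¹ : V →L[ℂ] V) (F f) = f := by simpa [K] using hf.apply_eq_smul
    have h2 : F f = shift A J t f + F f := by
      have := units_apply_inv_apply u (F f)
      rw [h1, hu] at this
      exact this.symm
    have h3 : shift A J t f = adjoint J 0 := by
      rw [map_zero]
      exact (right_eq_add.1 h2)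
    refine ⟨J f, fun h0 => hf.2 (hT.injective (by rw [h0, map_zero])), ?_⟩
    have := hT.mem_graph_of_shift h3
    rwa [add_zero] at this
  · refine absurd (hT.mem_resolventSet_of_isUnit ?_) hs
    have h1 : IsUnit (1 - K) := by
      simpa [_root_.spectrum.mem_resolventSet_iff] using h
    have h2 : shift A J t = ↑u * (1 - K) := by
      have : (↑u : V →L[ℂ] V) * K = F := by
        change (↑u : V →L[ℂ] V) * ((↑u⁻¹ : V →L[ℂ] V) * F) = F
        rw [← mul_assoc, u.mul_inv, one_mul]
      rw [mul_sub, this, mul_one, hu, add_sub_cancel_right]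
    rw [h2]
    exact u.isUnit.mul h1

theorem inner_mem_graph_re (hT : IsFormOperator A J T) {c C : ℝ} {E : Submodule ℂ H}
    [FiniteDimensional ℂ E]
    (hE : ∀ f, c * ‖J f‖ ^ 2 ≤ (⟪A f, f⟫_ℂ).re + C * ‖E.starProjection (J f)‖ ^ 2)
    {x h : H} (hx : (x, h) ∈ T.graph) (h0 : E.orthogonalProjectionOnto x = 0) :
    c * ‖x‖ ^ 2 ≤ (⟪h, x⟫_ℂ).re := by
  obtain ⟨f, rfl, hf⟩ := (hT.mem_graph _ _).1 hx
  have := hE f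
  rw [hf, ContinuousLinearMap.adjoint_inner_left, Submodule.starProjection_apply, h0] at this
  simpa using this

/-- The spectrum below such a level consists of finitely many eigenvalues: there are at most
`dim E` of them. -/
theorem finite_spectrum_below (hT : IsFormOperator A J T) {c C : ℝ} (hC : 0 ≤ C)
    {E : Submodule ℂ H} [FiniteDimensional ℂ E]
    (hE : ∀ f, c * ‖J f‖ ^ 2 ≤ (⟪A f, f⟫_ℂ).re + C * ‖E.starProjection (J f)‖ ^ 2) :
    {t : ℝ | t < c ∧ (t : ℂ) ∈ spectrum T}.Finite := by
  by_contra hinf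
  obtain ⟨s, hs, hcard⟩ := Set.Infinite.exists_subset_card_eq hinf (Module.finrank ℂ E + 1)
  have hx : ∀ t : s, ∃ x : H, x ≠ 0 ∧ (x, ((t : ℝ) : ℂ) • x) ∈ T.graph := fun t =>
    hT.exists_eigenvector hC hE (hs t.2).1 (hs t.2).2
  choose x hx0 hxT using hx
  have horth : Pairwise fun i j => ⟪x i, x j⟫_ℂ = 0 := fun i j hij => by
    have := hT.inner_graph_symm (hxT i) (hxT j)
    rw [inner_smul_left, inner_smul_right, Complex.conj_ofReal, ← sub_eq_zero, ← sub_mul,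
      mul_eq_zero] at this
    refine this.resolve_left fun h => hij (Subtype.ext ?_)
    exact_mod_cast sub_eq_zero.1 h
  -- More eigenvectors than `dim E`: a nonzero combination is orthogonal to `E`.
  have hdep : ¬ LinearIndependent ℂ fun i => E.orthogonalProjectionOnto (x i) := fun hli => by
    have := hli.fintype_card_le_finrank
    rw [Fintype.card_coe, hcard] at this
    omega
  rw [Fintype.not_linearIndependent_iff] at hdep
  obtain ⟨a, ha, i0, hi0⟩ := hdep
  have hy : (∑ i, a i • x i, ∑ i, a i • (((i : ℝ) : ℂ) • x i)) ∈ T.graph := by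
    have : (∑ i, a i • x i, ∑ i, a i • (((i : ℝ) : ℂ) • x i))
        = ∑ i, a i • (x i, ((i : ℝ) : ℂ) • x i) := by
      ext <;> simp [Prod.fst_sum, Prod.snd_sum]
    rw [this]
    exact Submodule.sum_mem _ fun i _ => Submodule.smul_mem _ _ (hxT i)
  have h1 := hT.inner_mem_graph_re hE hy (by rw [map_sum]; simpa using ha)
  have horth' : ∀ b d : s → ℂ, ⟪∑ i, b i • x i, ∑ i, d i • x i⟫_ℂ
      = ∑ i, (starRingEnd ℂ) (b i) * d i * (‖x i‖ ^ 2 : ℝ) := fun b d => by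
    rw [sum_inner]
    refine Finset.sum_congr rfl fun i _ => ?_
    rw [inner_sum, Finset.sum_eq_single i]
    · rw [inner_smul_left, inner_smul_right, inner_self_eq_norm_sq_to_K, mul_assoc]
      push_cast
      rfl
    · intro j _ hj
      rw [inner_smul_left, inner_smul_right, horth hj.symm, mul_zero, mul_zero]
    · simp
  have h2 : ‖∑ i, a i • x i‖ ^ 2 = ∑ i, ‖a i‖ ^ 2 * ‖x i‖ ^ 2 := by
    have e := horth' a a
    rw [inner_self_eq_norm_sq_to_K] at e
    have e2 : ∀ i, (starRingEnd ℂ) (a i) * a i * (‖x i‖ ^ 2 : ℝ)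
        = ((‖a i‖ ^ 2 * ‖x i‖ ^ 2 : ℝ) : ℂ) := fun i => by
      rw [Complex.conj_mul']
      push_cast
      rfl
    simp only [e2, ← Complex.ofReal_sum] at e
    exact Complex.ofReal_injective ((Complex.ofReal_pow _ _).trans e)
  have h3 : (⟪∑ i, a i • (((i : ℝ) : ℂ) • x i), ∑ i, a i • x i⟫_ℂ).re
      = ∑ i : s, (i : ℝ) * (‖a i‖ ^ 2 * ‖x i‖ ^ 2) := by
    simp only [smul_smul]
    rw [horth', Complex.re_sum]
    refine Finset.sum_congr rfl fun i _ => ?_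
    rw [map_mul, Complex.conj_ofReal, mul_right_comm (_ : ℂ) _ (a i), Complex.conj_mul']
    norm_cast
    ring
  rw [h2, h3, Finset.mul_sum] at h1
  refine absurd h1 (not_le.2 (Finset.sum_lt_sum (fun i _ => ?_) ⟨i0, Finset.mem_univ _, ?_⟩))
  · exact mul_le_mul_of_nonneg_right (hs i.2).1.le (by positivity)
  · have := norm_pos_iff.2 (hx0 i0)
    have := norm_pos_iff.2 hi0
    exact mul_lt_mul_of_pos_right (hs i0.2).1 (by positivity)

theorem mem_discreteSpectrum (hT : IsFormOperator A J T) {c C : ℝ} (hC : 0 ≤ C)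
    {E : Submodule ℂ H} [FiniteDimensional ℂ E]
    (hE : ∀ f, c * ‖J f‖ ^ 2 ≤ (⟪A f, f⟫_ℂ).re + C * ‖E.starProjection (J f)‖ ^ 2)
    {t : ℝ} (ht : t < c) (hs : (t : ℂ) ∈ spectrum T) : (t : ℂ) ∈ discreteSpectrum T := by
  have hmem : ∀ f : T.domain, f ∈ eigenspace T t ↔ T f = (t : ℂ) • (f : H) := fun f => by
    rw [eigenspace, LinearMap.mem_ker]
    exact sub_eq_zero
  refine ⟨hs, ?_, ?_, ?_⟩
  · have hfin := (hT.finite_spectrum_below hC hE).subset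
      (sdiff_subset (t := {t}))
    obtain ⟨ε, hε, hball⟩ := Metric.isOpen_iff.1 hfin.isClosed.isOpen_compl t (by simp)
    refine ⟨min ε (c - t), lt_min hε (sub_pos.2 ht), ?_⟩
    refine Subset.antisymm (fun z hz => ?_) (singleton_subset_iff.2 ⟨hs, ?_⟩)
    · obtain ⟨x, rfl⟩ : ∃ x : ℝ, (x : ℂ) = z := ⟨z.re, Complex.ext rfl (hT.spectrum_im hz.1).symm⟩
      have hd : |x - t| < min ε (c - t) := by
        have := hz.2
        rw [Metric.mem_ball, dist_eq_norm, ← Complex.ofReal_sub, Complex.norm_real] at this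
        exact this
      by_contra hne
      refine hball (Metric.mem_ball.2 (hd.trans_le (min_le_left _ _))) ⟨⟨?_, hz.1⟩, ?_⟩
      · have := (le_abs_self _).trans_lt (hd.trans_le (min_le_right _ _))
        linarith
      · rintro rfl
        exact hne rfl
    · exact Metric.mem_ball_self (lt_min hε (sub_pos.2 ht))
  · obtain ⟨x, hx0, hx⟩ := hT.exists_eigenvector hC hE ht hs
    obtain ⟨y, rfl, hy⟩ := (T.mem_graph_iff).1 hx
    refine (Submodule.ne_bot_iff _).2 ⟨y, (hmem y).2 hy, fun h => hx0 ?_⟩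
    rw [h]
    rfl
  · let P : eigenspace T t →ₗ[ℂ] E :=
      E.orthogonalProjectionOnto.toLinearMap ∘ₗ T.domain.subtype ∘ₗ (eigenspace T t).subtype
    refine FiniteDimensional.of_injective P ((injective_iff_map_eq_zero P).2 fun f hf => ?_)
    have h1 : (((f : T.domain) : H), (t : ℂ) • ((f : T.domain) : H)) ∈ T.graph := by
      rw [← (hmem f).1 f.2]
      exact T.mem_graph _
    have h2 := hT.inner_mem_graph_re hE h1 hf
    rw [inner_smul_left, inner_self_eq_norm_sq_to_K, Complex.conj_ofReal] at h2
    have h3 : c * ‖((f : T.domain) : H)‖ ^ 2 ≤ t * ‖((f : T.domain) : H)‖ ^ 2 := by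
      refine h2.trans_eq ?_
      simp only [Complex.re_ofReal_mul, Complex.coe_algebraMap, ← Complex.ofReal_pow,
        Complex.ofReal_re]
    have h4 : ‖((f : T.domain) : H)‖ ^ 2 = 0 := by nlinarith [sq_nonneg ‖((f : T.domain) : H)‖]
    refine Subtype.ext (Subtype.ext ?_)
    simpa using h4

/-- The essential spectrum is the half line `[b, ∞)` if the form is bounded below by every number
smaller than `b` up to a finite rank form, and if every number `t ≥ b` admits approximate
eigenvectors in the form sense. -/
theorem essentialSpectrum_eq (hT : IsFormOperator A J T) {b : ℝ}
    (hlow : ∀ c < b, ∃ C : ℝ, 0 ≤ C ∧ ∃ E : Submodule ℂ H, ∃ _ : FiniteDimensional ℂ E,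
      ∀ f, c * ‖J f‖ ^ 2 ≤ (⟪A f, f⟫_ℂ).re + C * ‖E.starProjection (J f)‖ ^ 2)
    (hweyl : ∀ t ≥ b, ∀ ε > 0, ∃ f, J f ≠ 0 ∧ ‖shift A J (t : ℂ) f‖ ≤ ε * ‖J f‖) :
    essentialSpectrum T = (fun t : ℝ => (t : ℂ)) '' Ici b := by
  have hspec : ∀ t ≥ b, (t : ℂ) ∈ spectrum T := fun t ht hres => by
    obtain ⟨C, hC⟩ := hT.exists_norm_le_of_mem_resolventSet hres
    obtain ⟨f, hf0, hf⟩ := hweyl t ht (1 / (2 * (|C| + 1))) (by positivity)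
    have h1 : ‖J f‖ ≤ (|C| + 1) * ‖shift A J (t : ℂ) f‖ :=
      (hC f).trans (by gcongr; linarith [le_abs_self C])
    have h2 : (|C| + 1) * ‖shift A J (t : ℂ) f‖ ≤ (|C| + 1) * (1 / (2 * (|C| + 1)) * ‖J f‖) := by
      gcongr
    have h3 : (|C| + 1) * (1 / (2 * (|C| + 1)) * ‖J f‖) = ‖J f‖ / 2 := by
      have : |C| + 1 ≠ 0 := by positivity
      field_simp
    have := norm_pos_iff.2 hf0
    linarith
  ext z
  refine ⟨fun hz => ?_, ?_⟩
  · obtain ⟨x, rfl⟩ : ∃ x : ℝ, (x : ℂ) = z := ⟨z.re, Complex.ext rfl (hT.spectrum_im hz.1).symm⟩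
    refine ⟨x, ?_, rfl⟩
    by_contra hx
    obtain ⟨c, hxc, hcb⟩ := exists_between (not_le.1 (mt mem_Ici.2 hx))
    obtain ⟨C, hC, E, _, hE⟩ := hlow c hcb
    exact hz.2 (hT.mem_discreteSpectrum hC hE hxc hz.1)
  · rintro ⟨t, ht, rfl⟩
    refine ⟨hspec t ht, fun hd => ?_⟩
    obtain ⟨-, ⟨ε, hε, hball⟩, -⟩ := hd
    have hmem : ((t + ε / 2 : ℝ) : ℂ) ∈ spectrum T ∩ Metric.ball (t : ℂ) ε := by
      refine ⟨hspec _ (le_trans ht (by linarith)), ?_⟩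
      rw [Metric.mem_ball, dist_eq_norm, ← Complex.ofReal_sub, Complex.norm_real, Real.norm_eq_abs,
        add_sub_cancel_left, abs_of_pos (by positivity)]
      linarith
    rw [hball, mem_singleton_iff, Complex.ofReal_inj] at hmem
    linarith

end IsFormOperator

end FormOperator

end LeakyWire

/-! ### The form domain as a Hilbert space -/

noncomputable section

namespace LeakyWire

open ContinuousLinearMap (adjoint)

theorem integral_mul_eq_inner {ψ : Plane → ℂ} (hψ : MemLp (star ψ) 2 (volume : Measure Plane))
    (f : L2) : ∫ x, f x * ψ x = ⟪hψ.toLp, f⟫_ℂ := by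
  rw [L2.inner_def]
  refine integral_congr_ae ?_
  filter_upwards [hψ.coeFn_toLp] with x hx
  rw [hx, RCLike.inner_apply]
  simp

theorem memLp_star_of_hasCompactSupport {ψ : Plane → ℂ} (hc : Continuous ψ)
    (hs : HasCompactSupport ψ) : MemLp (star ψ) 2 (volume : Measure Plane) :=
  (continuous_star.comp hc).memLp_of_hasCompactSupport (hs.comp_left (g := star) (star_zero ℂ))

theorem IsTestFunction.hasWeakGradient {f : L2} {G : Fin 2 → L2} {ψ : Plane → ℂ}
    (hψ : IsTestFunction ψ) (hf : f =ᵐ[volume] ψ) (hG : ∀ i, G i =ᵐ[volume] partialDeriv i ψ) :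
    HasWeakGradient f G := by
  intro i φ hφ
  have e1 : ∫ x, f x * partialDeriv i φ x = ∫ x, ψ x * partialDeriv i φ x :=
    integral_congr_ae (hf.mono fun x hx => by simp only [hx])
  have e2 : ∫ x, G i x * φ x = ∫ x, partialDeriv i ψ x * φ x :=
    integral_congr_ae ((hG i).mono fun x hx => by simp only [hx])
  rw [e1, e2]
  refine integral_mul_fderiv_eq_neg_fderiv_mul_of_integrable ?_ ?_ ?_ ?_ ?_
  · exact ((hψ.continuous_partialDeriv i).mul hφ.1.continuous).integrable_of_hasCompactSupport
      hφ.2.mul_left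
  · exact (hψ.1.continuous.mul (hφ.continuous_partialDeriv i)).integrable_of_hasCompactSupport
      hψ.2.mul_right
  · exact (hψ.1.continuous.mul hφ.1.continuous).integrable_of_hasCompactSupport hφ.2.mul_left
  · exact fun x _ => hψ.1.differentiable (by simp) x
  · exact fun x _ => hφ.1.differentiable (by simp) x

/-- A function with a trace, being a limit of test functions in the Sobolev norm, has a weak
gradient. -/
theorem HasTrace.hasWeakGradient {η : Measure Plane} {f : L2} {G : Fin 2 → L2} {u : Lp ℂ 2 η}
    (h : HasTrace η f G u) : HasWeakGradient f G := by
  intro i φ hφ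
  have m1 := memLp_star_of_hasCompactSupport (hφ.continuous_partialDeriv i)
    (hφ.hasCompactSupport_partialDeriv i)
  have m2 := memLp_star_of_hasCompactSupport hφ.1.continuous hφ.2
  have hcl : IsClosed {p : L2 × (Fin 2 → L2) × Lp ℂ 2 η |
      ⟪m1.toLp, p.1⟫_ℂ = -⟪m2.toLp, p.2.1 i⟫_ℂ} := isClosed_eq (by fun_prop) (by fun_prop)
  have hsub : (restrictionGraph η : Set (L2 × (Fin 2 → L2) × Lp ℂ 2 η)) ⊆
      {p | ⟪m1.toLp, p.1⟫_ℂ = -⟪m2.toLp, p.2.1 i⟫_ℂ} := by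
    rintro p ⟨ψ, hψ, h1, h2, -⟩
    have := hψ.hasWeakGradient h1 h2 i φ hφ
    rwa [integral_mul_eq_inner m1, integral_mul_eq_inner m2] at this
  have := closure_minimal hsub hcl h
  rw [integral_mul_eq_inner m1, integral_mul_eq_inner m2]
  exact this

/-- An `L²` function orthogonal to all test functions vanishes. -/
theorem eq_zero_of_forall_integral_mul_test {f : L2}
    (h : ∀ φ : Plane → ℂ, IsTestFunction φ → ∫ x, f x * φ x = 0) : f = 0 := by
  refine (Lp.eq_zero_iff_ae_eq_zero).2 (ae_eq_zero_of_integral_contDiff_smul_eq_zero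
    ((Lp.memLp f).locallyIntegrable (by norm_num)) fun g hg hs => ?_)
  rw [← h (fun x => (g x : ℂ)) ⟨Complex.ofRealCLM.contDiff.comp hg,
    hs.comp_left (g := fun t : ℝ => (t : ℂ)) Complex.ofReal_zero⟩]
  refine integral_congr_ae (Filter.Eventually.of_forall fun x => ?_)
  simp only [Complex.real_smul]
  ring

theorem IsTestFunction.exists_mem_restrictionGraph (η : Measure Plane) [IsFiniteMeasureOnCompacts η]
    {φ : Plane → ℂ} (hφ : IsTestFunction φ) : ∃ p ∈ restrictionGraph η, p.1 =ᵐ[volume] φ ∧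
      (∀ i, p.2.1 i =ᵐ[volume] partialDeriv i φ) ∧ p.2.2 =ᵐ[η] φ := by
  have h1 : MemLp φ 2 (volume : Measure Plane) :=
    hφ.1.continuous.memLp_of_hasCompactSupport hφ.2
  have h2 : ∀ i, MemLp (partialDeriv i φ) 2 (volume : Measure Plane) := fun i =>
    (hφ.continuous_partialDeriv i).memLp_of_hasCompactSupport (hφ.hasCompactSupport_partialDeriv i)
  have h3 : MemLp φ 2 η := hφ.1.continuous.memLp_of_hasCompactSupport hφ.2
  have h : (h1.toLp =ᵐ[volume] φ) ∧ (∀ i, (h2 i).toLp =ᵐ[volume] partialDeriv i φ) ∧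
      h3.toLp =ᵐ[η] φ := ⟨h1.coeFn_toLp, fun i => (h2 i).coeFn_toLp, h3.coeFn_toLp⟩
  exact ⟨(h1.toLp, fun i => (h2 i).toLp, h3.toLp), ⟨φ, hφ, h⟩, h⟩

/-- The Hilbert space of triples `(f, G, u)` of a function, a gradient and a trace. -/
def TripleSpace (η : Measure Plane) : Type :=
  WithLp 2 (L2 × WithLp 2 (PiLp 2 (fun _ : Fin 2 => L2) × Lp ℂ 2 η))

instance (η : Measure Plane) : NormedAddCommGroup (TripleSpace η) :=
  inferInstanceAs (NormedAddCommGroup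
    (WithLp 2 (L2 × WithLp 2 (PiLp 2 (fun _ : Fin 2 => L2) × Lp ℂ 2 η))))

instance (η : Measure Plane) : InnerProductSpace ℂ (TripleSpace η) :=
  inferInstanceAs (InnerProductSpace ℂ
    (WithLp 2 (L2 × WithLp 2 (PiLp 2 (fun _ : Fin 2 => L2) × Lp ℂ 2 η))))

instance (η : Measure Plane) : CompleteSpace (TripleSpace η) :=
  inferInstanceAs (CompleteSpace
    (WithLp 2 (L2 × WithLp 2 (PiLp 2 (fun _ : Fin 2 => L2) × Lp ℂ 2 η))))

/-- The components of a triple, as an element of the product with the product topology. -/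
def tripleCoords (η : Measure Plane) : TripleSpace η →L[ℂ] L2 × (Fin 2 → L2) × Lp ℂ 2 η :=
  (show WithLp 2 (L2 × WithLp 2 (PiLp 2 (fun _ : Fin 2 => L2) × Lp ℂ 2 η)) →L[ℂ]
      L2 × (Fin 2 → L2) × Lp ℂ 2 η from (WithLp.fstL 2 ℂ _ _).prod
    ((((PiLp.continuousLinearEquiv 2 ℂ (fun _ : Fin 2 => L2)).toContinuousLinearMap ∘L
      WithLp.fstL 2 ℂ _ _) ∘L WithLp.sndL 2 ℂ _ _).prod
      (WithLp.sndL 2 ℂ _ _ ∘L WithLp.sndL 2 ℂ _ _)))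

/-- The form domain: the Sobolev functions together with their gradient and trace. -/
def formDomain (η : Measure Plane) : Submodule ℂ (TripleSpace η) :=
  (restrictionGraph η).topologicalClosure.comap (tripleCoords η).toLinearMap

instance (η : Measure Plane) : CompleteSpace (formDomain η) := by
  have : IsClosed (formDomain η : Set (TripleSpace η)) :=
    (Submodule.isClosed_topologicalClosure _).preimage (tripleCoords η).continuous
  exact this.completeSpace_coe

/-- The embedding of the form domain into `L²`. -/
def formEmbed (η : Measure Plane) : formDomain η →L[ℂ] L2 :=
  (ContinuousLinearMap.fst ℂ _ _ ∘L tripleCoords η) ∘L (formDomain η).subtypeL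

/-- The `i`-th weak derivative on the form domain. -/
def formGrad (η : Measure Plane) (i : Fin 2) : formDomain η →L[ℂ] L2 :=
  (ContinuousLinearMap.proj i ∘L ContinuousLinearMap.fst ℂ (Fin 2 → L2) _ ∘L
    ContinuousLinearMap.snd ℂ L2 _ ∘L tripleCoords η) ∘L (formDomain η).subtypeL

/-- The trace on the form domain. -/
def formTrace (η : Measure Plane) : formDomain η →L[ℂ] Lp ℂ 2 η :=
  (ContinuousLinearMap.snd ℂ (Fin 2 → L2) _ ∘L
    ContinuousLinearMap.snd ℂ L2 _ ∘L tripleCoords η) ∘L (formDomain η).subtypeL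

theorem hasTrace_formDomain {η : Measure Plane} (f : formDomain η) :
    HasTrace η (formEmbed η f) (fun i => formGrad η i f) (formTrace η f) := f.2

/-- A closed condition on functions, gradients and traces that holds for test functions holds on
the form domain. -/
theorem formDomain_induction {η : Measure Plane} {P : L2 × (Fin 2 → L2) × Lp ℂ 2 η → Prop}
    (hcl : IsClosed {p | P p}) (h : ∀ p ∈ restrictionGraph η, P p) (f : formDomain η) :
    P (formEmbed η f, fun i => formGrad η i f, formTrace η f) :=
  closure_minimal (s := (restrictionGraph η : Set (L2 × (Fin 2 → L2) × Lp ℂ 2 η))) h hcl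
    (hasTrace_formDomain f)

theorem exists_formDomain_of_hasTrace {η : Measure Plane} {f : L2} {G : Fin 2 → L2} {u : Lp ℂ 2 η}
    (h : HasTrace η f G u) : ∃ F : formDomain η, formEmbed η F = f ∧
      (∀ i, formGrad η i F = G i) ∧ formTrace η F = u :=
  ⟨⟨WithLp.toLp 2 (f, WithLp.toLp 2 (WithLp.toLp 2 G, u)), h⟩, rfl, fun _ => rfl, rfl⟩

theorem formDomain_norm_sq {η : Measure Plane} (f : formDomain η) : ‖f‖ ^ 2 =
    ‖formEmbed η f‖ ^ 2 + (∑ i, ‖formGrad η i f‖ ^ 2) + ‖formTrace η f‖ ^ 2 := by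
  have h1 := WithLp.prod_norm_sq_eq_of_L2
    (show WithLp 2 (L2 × WithLp 2 (PiLp 2 (fun _ : Fin 2 => L2) × Lp ℂ 2 η)) from f.1)
  have h2 := WithLp.prod_norm_sq_eq_of_L2
    (show WithLp 2 (L2 × WithLp 2 (PiLp 2 (fun _ : Fin 2 => L2) × Lp ℂ 2 η)) from f.1).snd
  have h3 := PiLp.norm_sq_eq_of_L2 _
    (show WithLp 2 (L2 × WithLp 2 (PiLp 2 (fun _ : Fin 2 => L2) × Lp ℂ 2 η)) from f.1).snd.fst
  rw [h2, h3, ← add_assoc] at h1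
  exact h1

/-- The bounded operator on the form domain representing the form. -/
def formOp (α : ℝ) (η : Measure Plane) : formDomain η →L[ℂ] formDomain η :=
  (∑ i, adjoint (formGrad η i) ∘L formGrad η i) -
    (α : ℂ) • (adjoint (formTrace η) ∘L formTrace η)

theorem inner_formOp (α : ℝ) {η : Measure Plane} (g f : formDomain η) :
    ⟪g, formOp α η f⟫_ℂ = formValue α (fun i => formGrad η i g) (formTrace η g)
      (fun i => formGrad η i f) (formTrace η f) := by
  simp only [formOp, formValue, sub_apply, sum_apply, smul_apply,
    ContinuousLinearMap.comp_apply, inner_sub_right, inner_sum, inner_smul_right,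
    ContinuousLinearMap.adjoint_inner_right]

theorem formOp_symm (α : ℝ) {η : Measure Plane} (f g : formDomain η) :
    ⟪formOp α η f, g⟫_ℂ = ⟪f, formOp α η g⟫_ℂ := by
  rw [← inner_conj_symm, inner_formOp, inner_formOp]
  simp only [formValue, map_sub, map_sum, map_mul, inner_conj_symm, Complex.conj_ofReal]

theorem re_inner_formOp (α : ℝ) {η : Measure Plane} (f : formDomain η) :
    (⟪formOp α η f, f⟫_ℂ).re = (∑ i, ‖formGrad η i f‖ ^ 2) - α * ‖formTrace η f‖ ^ 2 := by
  rw [formOp_symm, inner_formOp, formValue]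
  simp only [inner_self_eq_norm_sq_to_K]
  rw [Complex.sub_re, Complex.re_sum, Complex.re_ofReal_mul]
  simp only [← Complex.ofReal_pow, Complex.coe_algebraMap, Complex.ofReal_re]

/-- The trace inequality with the constant of the straight line up to `ε`, and up to a finite rank
form in `L²` of the plane. -/
def HasTraceBound (η : Measure Plane) : Prop :=
  ∀ β > 0, ∀ ε > 0, ∃ C : ℝ, 0 ≤ C ∧ ∃ E : Submodule ℂ L2, ∃ _ : FiniteDimensional ℂ E,
    ∀ p ∈ restrictionGraph η, β * ‖p.2.2‖ ^ 2 ≤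
      (1 + ε) * (∑ i, ‖p.2.1 i‖ ^ 2) + β ^ 2 / 4 * ‖p.1‖ ^ 2 + C * ‖E.starProjection p.1‖ ^ 2

theorem HasTraceBound.formDomain_bound {η : Measure Plane} (h : HasTraceBound η) {β ε : ℝ}
    (hβ : 0 < β) (hε : 0 < ε) : ∃ C : ℝ, 0 ≤ C ∧ ∃ E : Submodule ℂ L2, ∃ _ : FiniteDimensional ℂ E,
    ∀ f : formDomain η, β * ‖formTrace η f‖ ^ 2 ≤ (1 + ε) * (∑ i, ‖formGrad η i f‖ ^ 2) +
      β ^ 2 / 4 * ‖formEmbed η f‖ ^ 2 + C * ‖E.starProjection (formEmbed η f)‖ ^ 2 := by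
  obtain ⟨C, hC, E, hE, hb⟩ := h β hβ ε hε
  exact ⟨C, hC, E, hE, formDomain_induction (isClosed_le (by fun_prop) (by fun_prop)) hb⟩

theorem HasTraceBound.coercive {η : Measure Plane} (h : HasTraceBound η) {α : ℝ} (hα : 0 < α) :
    ∃ m δ : ℝ, 0 < δ ∧ ∀ f : formDomain η,
      δ * ‖f‖ ^ 2 ≤ (⟪formOp α η f, f⟫_ℂ).re + m * ‖formEmbed η f‖ ^ 2 := by
  obtain ⟨C, hC, E, _, hb⟩ := h.formDomain_bound (β := 4 * (α + 1)) (by positivity) one_pos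
  refine ⟨(α + 1) ^ 2 + C / 4 + 1, 1 / 2, by norm_num, fun f => ?_⟩
  have h1 := hb f
  have h2 : ‖E.starProjection (formEmbed η f)‖ ^ 2 ≤ ‖formEmbed η f‖ ^ 2 := by
    gcongr
    exact E.norm_starProjection_apply_le _
  have h3 := mul_le_mul_of_nonneg_left h2 hC
  rw [re_inner_formOp, formDomain_norm_sq]
  nlinarith [sq_nonneg ‖formTrace η f‖, sq_nonneg ‖formEmbed η f‖]

theorem mem_formGraph_iff (α : ℝ) {η : Measure Plane} (x h : L2) :
    (x, h) ∈ formGraph α η ↔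
      ∃ f, formEmbed η f = x ∧ formOp α η f = adjoint (formEmbed η) h := by
  constructor
  · rintro ⟨G, u, -, hu, hv⟩
    obtain ⟨F, rfl, hG, rfl⟩ := exists_formDomain_of_hasTrace hu
    obtain rfl : G = fun i => formGrad η i F := funext fun i => (hG i).symm
    refine ⟨F, rfl, ext_inner_left ℂ fun g => ?_⟩
    rw [inner_formOp, ContinuousLinearMap.adjoint_inner_right]
    exact hv _ _ _ (hasTrace_formDomain g).hasWeakGradient (hasTrace_formDomain g)
  · rintro ⟨F, rfl, hF⟩
    refine ⟨_, _, (hasTrace_formDomain F).hasWeakGradient, hasTrace_formDomain F,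
      fun g K v _ hv => ?_⟩
    obtain ⟨g, rfl, hK, rfl⟩ := exists_formDomain_of_hasTrace hv
    obtain rfl : K = fun i => formGrad η i g := funext fun i => (hK i).symm
    rw [← inner_formOp, hF, ContinuousLinearMap.adjoint_inner_right]

theorem isFormOperator {η : Measure Plane} [IsFiniteMeasureOnCompacts η] (h : HasTraceBound η)
    {α : ℝ} (hα : 0 < α) :
    IsFormOperator (formOp α η) (formEmbed η) (formGraph α η).toLinearPMap := by
  have hco := h.coercive hα
  have hinj : Function.Injective (formEmbed η) := by
    refine (injective_iff_map_eq_zero _).2 fun f hf => ?_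
    have hG : ∀ i, formGrad η i f = 0 := fun i => by
      refine eq_zero_of_forall_integral_mul_test fun φ hφ => ?_
      have h1 := (hasTrace_formDomain f).hasWeakGradient i φ hφ
      rw [hf] at h1
      have h2 : ∫ x, (0 : L2) x * partialDeriv i φ x = 0 := by
        refine integral_eq_zero_of_ae ?_
        filter_upwards [Lp.coeFn_zero ℂ 2 (volume : Measure Plane)] with x hx
        rw [hx]
        simp
      rw [h2] at h1
      exact neg_eq_zero.1 h1.symm
    -- The negative sign of the trace term turns the coercivity into `u = 0`.
    obtain ⟨m, δ, hδ, hc⟩ := hco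
    have h1 := hc f
    rw [re_inner_formOp, hf] at h1
    simp only [hG, norm_zero] at h1
    have h2 : ‖f‖ ^ 2 ≤ 0 := by
      have : 0 ≤ α * ‖formTrace η f‖ ^ 2 := by positivity
      have h3 := h1.trans_eq (by simp : _ = -(α * ‖formTrace η f‖ ^ 2))
      nlinarith
    simpa using h2
  have hdense : ∀ h, adjoint (formEmbed η) h = 0 → h = 0 := fun h hh => by
    refine eq_zero_of_forall_integral_mul_test fun φ hφ => ?_
    have hφ' : IsTestFunction (star φ) :=
      ⟨Complex.conjCLE.contDiff.comp hφ.1, hφ.2.comp_left (g := star) (star_zero ℂ)⟩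
    obtain ⟨p, hp, hp1, -⟩ := hφ'.exists_mem_restrictionGraph η
    obtain ⟨F, hF, -⟩ := exists_formDomain_of_hasTrace (η := η) (f := p.1) (G := p.2.1) (u := p.2.2)
      (subset_closure hp)
    have h0 : ⟪formEmbed η F, h⟫_ℂ = 0 := by
      rw [← ContinuousLinearMap.adjoint_inner_right, hh, inner_zero_right]
    rw [hF, L2.inner_def] at h0
    rw [← h0]
    refine integral_congr_ae ?_
    filter_upwards [hp1] with x hx
    rw [hx, RCLike.inner_apply]
    simp
  refine ⟨formOp_symm α, hinj, hdense, hco, fun x h => ?_⟩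
  rw [Submodule.toLinearPMap_graph_eq, mem_formGraph_iff]
  rintro ⟨x, h⟩ hx h0
  obtain ⟨f, hf, hf2⟩ := (mem_formGraph_iff α x h).1 hx
  obtain rfl : f = 0 := hinj (by rw [hf, map_zero]; exact h0)
  exact hdense h (by rw [← hf2, map_zero])

/-- For every spectral parameter `t ≥ -α² / 4` there are test functions for which the form minus
`t` is small in the dual of the Sobolev norm. -/
def HasWeylSequences (α : ℝ) (η : Measure Plane) : Prop :=
  ∀ t ≥ -(1 / 4) * α ^ 2, ∀ ε > 0, ∃ p ∈ restrictionGraph η, p.1 ≠ 0 ∧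
    ∀ q ∈ restrictionGraph η, ‖formValue α q.2.1 q.2.2 p.2.1 p.2.2 - (t : ℂ) * ⟪q.1, p.1⟫_ℂ‖ ≤
      ε * ‖p.1‖ * (‖q.1‖ + (∑ i, ‖q.2.1 i‖) + ‖q.2.2‖)

/-- The trace bound makes the form closed and semibounded, with discrete spectrum below
`-α² / 4`; the Weyl sequences fill the half line above. -/
theorem isSelfAdjoint_and_essentialSpectrum_eq {η : Measure Plane} [IsFiniteMeasureOnCompacts η]
    (hb : HasTraceBound η) {α : ℝ} (hα : 0 < α) (hw : HasWeylSequences α η) :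
    IsSelfAdjoint (formGraph α η).toLinearPMap ∧
    essentialSpectrum (formGraph α η).toLinearPMap =
      (fun t : ℝ => (t : ℂ)) '' Ici (-(1 / 4) * α ^ 2) := by
  have hT := isFormOperator hb hα
  refine ⟨hT.isSelfAdjoint, hT.essentialSpectrum_eq (fun c hc => ?_) fun t ht ε hε => ?_⟩
  · -- The trace bound for `β = α (1 + ε)` with `-(1 + ε) α² / 4 = c`.
    set ε : ℝ := -4 * c / α ^ 2 - 1
    have hα2 : 0 < α ^ 2 := by positivity
    have hε : 0 < ε := by
      rw [sub_pos, lt_div_iff₀ hα2]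
      linarith
    have hce : c = -((1 + ε) * (α ^ 2 / 4)) := by
      simp only [ε]
      field_simp
      ring
    obtain ⟨C, hC, E, hE, h⟩ := hb.formDomain_bound (β := α * (1 + ε)) (by positivity) hε
    refine ⟨C / (1 + ε), by positivity, E, hE, fun f => ?_⟩
    have h1 := h f
    rw [re_inner_formOp, hce]
    have e1 : C / (1 + ε) * ‖E.starProjection (formEmbed η f)‖ ^ 2 * (1 + ε)
        = C * ‖E.starProjection (formEmbed η f)‖ ^ 2 := by
      field_simp
    have hpos : 0 < 1 + ε := by positivity
    refine le_of_mul_le_mul_right ?_ hpos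
    rw [add_mul _ _ (1 + ε), e1]
    linarith
  · obtain ⟨p, hp, hp0, hp2⟩ := hw t ht (ε / 4) (by positivity)
    obtain ⟨F, hF, hG, hU⟩ := exists_formDomain_of_hasTrace (η := η) (f := p.1) (G := p.2.1)
      (u := p.2.2) (subset_closure hp)
    refine ⟨F, hF ▸ hp0, ?_⟩
    have key : ∀ g : formDomain η, ‖⟪g, shift (formOp α η) (formEmbed η) t F⟫_ℂ‖ ≤
        ε / 4 * ‖p.1‖ * (‖formEmbed η g‖ + (∑ i, ‖formGrad η i g‖) + ‖formTrace η g‖) := fun g => by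
      have h1 := formDomain_induction (by
        unfold formValue
        exact isClosed_le (by fun_prop) (by fun_prop)) hp2 g
      rw [shift_apply, inner_sub_right, inner_smul_right, inner_formOp, hF, hU,
        ContinuousLinearMap.adjoint_inner_right, show (fun i => formGrad η i F) = p.2.1 from
          funext hG]
      exact h1
    have hn : ∀ g : formDomain η,
        ‖formEmbed η g‖ + (∑ i, ‖formGrad η i g‖) + ‖formTrace η g‖ ≤ 4 * ‖g‖ := fun g => by
      have h1 := formDomain_norm_sq g
      rw [Fin.sum_univ_two] at h1 ⊢
      have e0 := sq_nonneg ‖formEmbed η g‖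
      have e1 := sq_nonneg ‖formGrad η 0 g‖
      have e2 := sq_nonneg ‖formGrad η 1 g‖
      have e3 := sq_nonneg ‖formTrace η g‖
      have a1 : ‖formEmbed η g‖ ≤ ‖g‖ := le_of_sq_le_sq (by linarith) (norm_nonneg _)
      have a2 : ‖formGrad η 0 g‖ ≤ ‖g‖ := le_of_sq_le_sq (by linarith) (norm_nonneg _)
      have a3 : ‖formGrad η 1 g‖ ≤ ‖g‖ := le_of_sq_le_sq (by linarith) (norm_nonneg _)
      have a4 : ‖formTrace η g‖ ≤ ‖g‖ := le_of_sq_le_sq (by linarith) (norm_nonneg _)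
      linarith
    set r := shift (formOp α η) (formEmbed η) t F
    have h1 : ‖r‖ * ‖r‖ ≤ ε * ‖p.1‖ * ‖r‖ := by
      have h2 := key r
      rw [inner_self_eq_norm_sq_to_K] at h2
      have h3 : ε / 4 * ‖p.1‖ * (‖formEmbed η r‖ + (∑ i, ‖formGrad η i r‖) + ‖formTrace η r‖) ≤
        ε / 4 * ‖p.1‖ * (4 * ‖r‖) := by gcongr; exact hn r
      have h4 : ‖((‖r‖ : ℂ)) ^ 2‖ = ‖r‖ * ‖r‖ := by
        rw [norm_pow, Complex.norm_real, norm_norm, sq]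
      have h5 := h4.symm.trans_le (h2.trans h3)
      linarith
    rw [hF]
    rcases (norm_nonneg r).eq_or_lt with h0 | h0
    · rw [← h0]
      positivity
    · exact le_of_mul_le_mul_right h1 h0

end LeakyWire

end

/-! ### A trace inequality on convex cells -/

namespace LeakyWire

open scoped ENNReal NNReal

theorem sq_lintegral_le {X : Type*} [MeasurableSpace X] (μ : Measure X) {f : X → ℝ≥0∞}
    (hf : AEMeasurable f μ) : (∫⁻ x, f x ∂μ) ^ 2 ≤ μ univ * ∫⁻ x, f x ^ 2 ∂μ := by
  have h := ENNReal.lintegral_mul_le_Lp_mul_Lq μ Real.HolderConjugate.two_two hf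
    (aemeasurable_const (b := (1 : ℝ≥0∞)))
  simp only [Pi.mul_apply, mul_one, ENNReal.one_rpow, lintegral_const, one_mul] at h
  calc (∫⁻ x, f x ∂μ) ^ 2
      ≤ ((∫⁻ x, f x ^ (2 : ℝ) ∂μ) ^ (1 / 2 : ℝ) * μ univ ^ (1 / 2 : ℝ)) ^ 2 := by gcongr
    _ = μ univ * ∫⁻ x, f x ^ 2 ∂μ := by
        rw [mul_pow, ← ENNReal.rpow_natCast, ← ENNReal.rpow_natCast, ← ENNReal.rpow_mul,
          ← ENNReal.rpow_mul]
        norm_num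
        rw [mul_comm]

/-- A measure on the plane has linear growth if the mass of a ball is at most proportional to the
radius. -/
def HasLinearGrowth (η : Measure Plane) : Prop :=
  ∃ K : ℝ≥0, ∀ z : Plane, ∀ r : ℝ, 0 < r → η (Metric.closedBall z r) ≤ K * ENNReal.ofReal r

theorem HasLinearGrowth.isFiniteMeasureOnCompacts {η : Measure Plane} (h : HasLinearGrowth η) :
    IsFiniteMeasureOnCompacts η := by
  obtain ⟨K, hK⟩ := h
  refine ⟨fun S hS => ?_⟩
  obtain ⟨r, hr, hSr⟩ := hS.isBounded.subset_closedBall_lt 0 0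
  exact (measure_mono hSr).trans_lt ((hK 0 r hr).trans_lt
    (ENNReal.mul_lt_top ENNReal.coe_lt_top ENNReal.ofReal_lt_top))

/-- Along the segment from `x` to `y`, run through as `x + s² (y - x)`. With this parametrization
the powers of `s` coming from the speed, from the change of variables in the plane and from the
linear growth of the measure cancel in the trace inequality. -/
theorem enorm_sub_sq_le {φ : Plane → ℂ} (hφ : ContDiff ℝ 1 φ) {x y : Plane} {d : ℝ}
    (hd : ‖y - x‖ ≤ d) : ‖φ x - φ y‖ₑ ^ 2 ≤ ∫⁻ s in Ioc (0 : ℝ) 1,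
      ENNReal.ofReal (4 * d ^ 2 * s ^ 2) * ‖fderiv ℝ φ (x + s ^ 2 • (y - x))‖ₑ ^ 2 := by
  set c : ℝ → ℂ := fun s => fderiv ℝ φ (x + s ^ 2 • (y - x)) ((2 * s) • (y - x))
  have hder : ∀ s : ℝ, HasDerivAt (fun s : ℝ => φ (x + s ^ 2 • (y - x))) (c s) s := fun s => by
    have h1 : HasDerivAt (fun s : ℝ => x + s ^ 2 • (y - x)) ((2 * s) • (y - x)) s := by
      have := ((hasDerivAt_pow 2 s).smul_const (y - x)).const_add x
      simpa using this
    exact ((hφ.differentiable one_ne_zero _).hasFDerivAt.comp_hasDerivAt s h1)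
  have hcont : Continuous c :=
    ((hφ.continuous_fderiv one_ne_zero).comp (by fun_prop)).clm_apply (by fun_prop)
  have h1 : ∫ s in (0 : ℝ)..1, c s = φ y - φ x := by
    rw [intervalIntegral.integral_eq_sub_of_hasDerivAt (fun s _ => hder s)
      (hcont.intervalIntegrable _ _)]
    simp
  have h2 : ‖φ x - φ y‖ₑ ≤ ∫⁻ s in Ioc (0 : ℝ) 1, ‖c s‖ₑ := by
    rw [← enorm_neg, neg_sub, ← h1, intervalIntegral.integral_of_le zero_le_one]
    exact enorm_integral_le_lintegral_enorm _
  calc ‖φ x - φ y‖ₑ ^ 2 ≤ (∫⁻ s in Ioc (0 : ℝ) 1, ‖c s‖ₑ) ^ 2 := by gcongr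
    _ ≤ _ := sq_lintegral_le _ hcont.measurable.enorm.aemeasurable
    _ = ∫⁻ s in Ioc (0 : ℝ) 1, ‖c s‖ₑ ^ 2 := by simp
    _ ≤ _ := by
      refine setLIntegral_mono' measurableSet_Ioc fun s hs => ?_
      have e : ENNReal.ofReal (4 * d ^ 2 * s ^ 2) = ENNReal.ofReal (2 * s * d) ^ 2 := by
        rw [← ENNReal.ofReal_pow (by have := hs.1; have := (norm_nonneg _).trans hd; positivity)]
        ring_nf
      rw [e, ← mul_pow]
      gcongr
      rw [← ofReal_norm, ← ofReal_norm, ← ENNReal.ofReal_mul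
        (by have := hs.1; have := (norm_nonneg _).trans hd; positivity)]
      refine ENNReal.ofReal_le_ofReal ?_
      refine (ContinuousLinearMap.le_opNorm _ _).trans ?_
      rw [norm_smul, Real.norm_of_nonneg (by linarith [hs.1]), mul_comm (2 * s * d)]
      have := hs.1
      gcongr

theorem lintegral_homothety (x : Plane) {c : ℝ} (hc : 0 < c) {f : Plane → ℝ≥0∞}
    (hf : Measurable f) :
    ∫⁻ y, f (x + c • (y - x)) = ENNReal.ofReal ((c ^ 2)⁻¹) * ∫⁻ z, f z := by
  have h1 : ∫⁻ y, f (x + c • (y - x)) = ∫⁻ y, f (x + c • y) :=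
    lintegral_sub_right_eq_self (fun y => f (x + c • y)) x
  have h2 : ∫⁻ y, f (x + c • y) = ∫⁻ y, f (x + y) ∂(Measure.map (c • ·) volume) := by
    rw [lintegral_map (by fun_prop) (by fun_prop)]
  rw [h1, h2, Measure.map_addHaar_smul _ hc.ne', lintegral_smul_measure,
    lintegral_add_left_eq_self, finrank_euclideanSpace_fin, abs_of_pos (by positivity)]
  rfl

/-- The trace inequality on a convex cell `Q` of diameter at most `d`, for a measure of linear
growth: the deviation from the mean value over the cell is controlled by the gradient, with a
constant that is small for small cells. -/
theorem setLIntegral_sub_average_sq_le {η : Measure Plane} [SFinite η] {K : ℝ≥0}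
    (hK : ∀ z : Plane, ∀ r : ℝ, 0 < r → η (Metric.closedBall z r) ≤ K * ENNReal.ofReal r)
    {Q : Set Plane} (hQm : MeasurableSet Q) (hQc : Convex ℝ Q) {d : ℝ} (hd : 0 < d)
    (hQd : ∀ x ∈ Q, ∀ y ∈ Q, ‖y - x‖ ≤ d) (hQ0 : volume Q ≠ 0) (hQt : volume Q ≠ ⊤)
    {φ : Plane → ℂ} (hφ : ContDiff ℝ 1 φ) :
    ∫⁻ x in Q, ‖φ x - ⨍ y in Q, φ y‖ₑ ^ 2 ∂η ≤
      (volume Q)⁻¹ * (4 * K * ENNReal.ofReal d ^ 3) * ∫⁻ z in Q, ‖fderiv ℝ φ z‖ₑ ^ 2 := by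
  set D : Plane → ℝ≥0∞ := fun z => ‖fderiv ℝ φ z‖ₑ ^ 2
  have hDm : Measurable D := ((hφ.continuous_fderiv one_ne_zero).measurable.enorm).pow_const 2
  have hbdd : Bornology.IsBounded Q := by
    rw [Metric.isBounded_iff]
    exact ⟨d, fun x hx y hy => by rw [dist_comm, dist_eq_norm]; exact hQd x hx y hy⟩
  have hint : IntegrableOn φ Q :=
    (hφ.continuous.continuousOn.integrableOn_compact hbdd.isCompact_closure).mono_set subset_closure
  have : IsFiniteMeasure (volume.restrict Q) := ⟨by
    rw [Measure.restrict_apply_univ]; exact hQt.lt_top⟩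
  have hpt : ∀ x, ‖φ x - ⨍ y in Q, φ y‖ₑ ^ 2 ≤
      (volume Q)⁻¹ * ∫⁻ y in Q, ‖φ x - φ y‖ₑ ^ 2 := fun x => by
    have h0 : volume.real Q ≠ 0 := (ENNReal.toReal_ne_zero).2 ⟨hQ0, hQt⟩
    have h1 : φ x - ⨍ y in Q, φ y = (volume.real Q)⁻¹ • ∫ y in Q, (φ x - φ y) := by
      rw [integral_sub (integrable_const _) hint, setAverage_eq, setIntegral_const, smul_sub,
        smul_smul, inv_mul_cancel₀ h0, one_smul]
    have h2 : ‖(volume.real Q)⁻¹‖ₑ = (volume Q)⁻¹ := by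
      rw [Real.enorm_of_nonneg (by positivity), ENNReal.ofReal_inv_of_pos
        (lt_of_le_of_ne measureReal_nonneg h0.symm), ofReal_measureReal hQt]
    rw [h1, enorm_smul, h2, mul_pow]
    calc (volume Q)⁻¹ ^ 2 * ‖∫ y in Q, (φ x - φ y)‖ₑ ^ 2
        ≤ (volume Q)⁻¹ ^ 2 * (volume Q * ∫⁻ y in Q, ‖φ x - φ y‖ₑ ^ 2) := by
          gcongr
          refine (pow_le_pow_left' (enorm_integral_le_lintegral_enorm _) 2).trans ?_
          have := sq_lintegral_le (volume.restrict Q) (f := fun y => ‖φ x - φ y‖ₑ)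
            (by have := hφ.continuous; fun_prop)
          rwa [Measure.restrict_apply_univ] at this
      _ = _ := by
          rw [← mul_assoc, sq, mul_assoc _ _ (volume Q), ENNReal.inv_mul_cancel hQ0 hQt, mul_one]
  have hmeas : Measurable fun p : (Plane × Plane) × ℝ =>
      ENNReal.ofReal (4 * d ^ 2 * p.2 ^ 2) * D (p.1.1 + p.2 ^ 2 • (p.1.2 - p.1.1)) := by
    fun_prop
  -- The part of the inequality for a fixed value `s` of the parameter on the segments.
  have hs : ∀ s ∈ Ioc (0 : ℝ) 1, ∫⁻ x in Q, ∫⁻ y in Q,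
      ENNReal.ofReal (4 * d ^ 2 * s ^ 2) * D (x + s ^ 2 • (y - x)) ∂volume ∂η ≤
      4 * K * ENNReal.ofReal d ^ 3 * ∫⁻ z in Q, D z := fun s hs => by
    have hs0 := hs.1
    set G : Plane → Plane → ℝ≥0∞ := fun x z =>
      (Metric.closedBall x (s ^ 2 * d)).indicator (Q.indicator D) z
    have hGm : ∀ x, Measurable (G x) := fun x =>
      (hDm.indicator hQm).indicator Metric.isClosed_closedBall.measurableSet
    have hGm2 : Measurable (Function.uncurry G) := by
      have hset : MeasurableSet {p : Plane × Plane | p.2 ∈ Metric.closedBall p.1 (s ^ 2 * d)} :=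
        (isClosed_le (f := fun p : Plane × Plane => dist p.2 p.1) (by fun_prop)
          continuous_const).measurableSet
      exact ((hDm.indicator hQm).comp measurable_snd).indicator hset
    have h1 : ∀ x ∈ Q, ∫⁻ y in Q, D (x + s ^ 2 • (y - x)) ≤
        ENNReal.ofReal (((s ^ 2) ^ 2)⁻¹) * ∫⁻ z, G x z := fun x hx => by
      rw [← lintegral_homothety x (by positivity) (hGm x)]
      refine (setLIntegral_mono' hQm fun y hy => ?_).trans (setLIntegral_le_lintegral Q _)
      have hz : x + s ^ 2 • (y - x) ∈ Q :=
        hQc.add_smul_sub_mem hx hy ⟨by positivity, pow_le_one₀ hs0.le hs.2⟩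
      have hz2 : x + s ^ 2 • (y - x) ∈ Metric.closedBall x (s ^ 2 * d) := by
        rw [Metric.mem_closedBall, dist_eq_norm, add_sub_cancel_left, norm_smul,
          Real.norm_of_nonneg (by positivity)]
        gcongr
        exact hQd x hx y hy
      simp only [G, indicator_of_mem hz2, indicator_of_mem hz, le_refl]
    have h2 : ∫⁻ x in Q, ∫⁻ z, G x z ∂volume ∂η ≤
        (K * ENNReal.ofReal (s ^ 2 * d)) * ∫⁻ z in Q, D z := by
      rw [lintegral_lintegral_swap hGm2.aemeasurable, ← lintegral_indicator hQm,
        ← lintegral_const_mul _ (hDm.indicator hQm)]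
      refine lintegral_mono fun z => ?_
      have e : ∀ x, G x z = (Metric.closedBall z (s ^ 2 * d)).indicator
          (fun _ => Q.indicator D z) x := fun x => by
        simp only [G, Set.indicator, Metric.mem_closedBall, dist_comm z x]
      simp only [e]
      rw [lintegral_indicator_const Metric.isClosed_closedBall.measurableSet, mul_comm]
      gcongr
      exact (Measure.restrict_apply_le _ _).trans (hK z _ (by positivity))
    calc ∫⁻ x in Q, ∫⁻ y in Q,
          ENNReal.ofReal (4 * d ^ 2 * s ^ 2) * D (x + s ^ 2 • (y - x)) ∂volume ∂η
        ≤ ∫⁻ x in Q, ENNReal.ofReal (4 * d ^ 2 * s ^ 2) *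
            (ENNReal.ofReal (((s ^ 2) ^ 2)⁻¹) * ∫⁻ z, G x z) ∂η := by
          refine setLIntegral_mono' hQm fun x hx => ?_
          rw [lintegral_const_mul _ (by fun_prop)]
          gcongr
          exact h1 x hx
      _ = ENNReal.ofReal (4 * d ^ 2 * s ^ 2) * (ENNReal.ofReal (((s ^ 2) ^ 2)⁻¹) *
            ∫⁻ x in Q, ∫⁻ z, G x z ∂volume ∂η) := by
          have hm : Measurable fun x => ∫⁻ z, G x z := hGm2.lintegral_prod_right'
          rw [lintegral_const_mul _ (hm.const_mul _), lintegral_const_mul _ hm]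
      _ ≤ ENNReal.ofReal (4 * d ^ 2 * s ^ 2) * (ENNReal.ofReal (((s ^ 2) ^ 2)⁻¹) *
            ((K * ENNReal.ofReal (s ^ 2 * d)) * ∫⁻ z in Q, D z)) := by gcongr
      _ = ENNReal.ofReal (4 * d ^ 2 * s ^ 2 * ((s ^ 2) ^ 2)⁻¹ * (s ^ 2 * d)) * K *
            ∫⁻ z in Q, D z := by
          rw [ENNReal.ofReal_mul (q := s ^ 2 * d) (by positivity),
            ENNReal.ofReal_mul (q := ((s ^ 2) ^ 2)⁻¹) (by positivity)]
          ring
      _ = _ := by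
          have : 4 * d ^ 2 * s ^ 2 * ((s ^ 2) ^ 2)⁻¹ * (s ^ 2 * d) = 4 * d ^ 3 := by
            field_simp
          rw [this, ENNReal.ofReal_mul (by norm_num), ENNReal.ofReal_pow hd.le]
          norm_num
          ring
  calc ∫⁻ x in Q, ‖φ x - ⨍ y in Q, φ y‖ₑ ^ 2 ∂η
      ≤ ∫⁻ x in Q, (volume Q)⁻¹ * ∫⁻ y in Q, (∫⁻ s in Ioc (0 : ℝ) 1,
          ENNReal.ofReal (4 * d ^ 2 * s ^ 2) * D (x + s ^ 2 • (y - x))) ∂volume ∂η := by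
        refine setLIntegral_mono' hQm fun x hx => (hpt x).trans ?_
        exact mul_le_mul' le_rfl
          (setLIntegral_mono' hQm fun y hy => enorm_sub_sq_le hφ (hQd x hx y hy))
    _ = (volume Q)⁻¹ * ∫⁻ x in Q, ∫⁻ y in Q, (∫⁻ s in Ioc (0 : ℝ) 1,
          ENNReal.ofReal (4 * d ^ 2 * s ^ 2) * D (x + s ^ 2 • (y - x))) ∂volume ∂η :=
        lintegral_const_mul _ (hmeas.lintegral_prod_right').lintegral_prod_right'
    _ = (volume Q)⁻¹ * ∫⁻ s in Ioc (0 : ℝ) 1, ∫⁻ x in Q, ∫⁻ y in Q,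
          ENNReal.ofReal (4 * d ^ 2 * s ^ 2) * D (x + s ^ 2 • (y - x)) ∂volume ∂η := by
        congr 1
        have hm : Measurable fun p : Plane × ℝ => ∫⁻ y in Q,
            ENNReal.ofReal (4 * d ^ 2 * p.2 ^ 2) * D (p.1 + p.2 ^ 2 • (y - p.1)) :=
          Measurable.lintegral_prod_right' (f := fun q : (Plane × ℝ) × Plane =>
            ENNReal.ofReal (4 * d ^ 2 * q.1.2 ^ 2) * D (q.1.1 + q.1.2 ^ 2 • (q.2 - q.1.1)))
            (by fun_prop)
        exact (lintegral_congr fun x => lintegral_lintegral_swap (by fun_prop)).trans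
          (lintegral_lintegral_swap hm.aemeasurable)
    _ ≤ (volume Q)⁻¹ * ∫⁻ s in Ioc (0 : ℝ) 1,
          4 * K * ENNReal.ofReal d ^ 3 * ∫⁻ z in Q, D z := by
        exact mul_le_mul' le_rfl (setLIntegral_mono' measurableSet_Ioc hs)
    _ = _ := by
        rw [setLIntegral_const]
        simp [mul_assoc]

end LeakyWire

/-! ### Trace estimates by a partition into small cells -/

namespace LeakyWire

open scoped ENNReal NNReal

/-- The half open square cell of side `h` with lower left corner `h n`. -/
def cell (h : ℝ) (n : Fin 2 → ℤ) : Set Plane := {x | ∀ i, x i ∈ Ico (h * n i) (h * (n i + 1))}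

theorem cell_eq_preimage (h : ℝ) (n : Fin 2 → ℤ) : cell h n =
    WithLp.ofLp ⁻¹' (univ.pi fun i => Ico (h * n i) (h * (n i + 1))) := by
  ext x
  simp [cell]

theorem measurableSet_cell (h : ℝ) (n : Fin 2 → ℤ) : MeasurableSet (cell h n) := by
  rw [cell_eq_preimage]
  exact (PiLp.volume_preserving_ofLp (Fin 2)).measurable
    (MeasurableSet.univ_pi fun i => measurableSet_Ico)

theorem volume_cell {h : ℝ} (hh : 0 < h) (n : Fin 2 → ℤ) :
    volume (cell h n) = ENNReal.ofReal (h ^ 2) := by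
  rw [cell_eq_preimage, (PiLp.volume_preserving_ofLp (Fin 2)).measure_preimage
    (MeasurableSet.univ_pi fun i => measurableSet_Ico).nullMeasurableSet, Real.volume_pi_Ico,
    Fin.prod_univ_two, ← ENNReal.ofReal_mul (by nlinarith)]
  congr 1
  ring

theorem convex_cell (h : ℝ) (n : Fin 2 → ℤ) : Convex ℝ (cell h n) := by
  intro x hx y hy a b ha hb hab i
  exact convex_Ico _ _ (hx i) (hy i) ha hb hab

theorem norm_sub_le_of_mem_cell {h : ℝ} (hh : 0 < h) {n : Fin 2 → ℤ} {x y : Plane}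
    (hx : x ∈ cell h n) (hy : y ∈ cell h n) : ‖y - x‖ ≤ 2 * h := by
  have key : ∀ i, (y i - x i) ^ 2 ≤ h ^ 2 := fun i => by
    have := hx i
    have := hy i
    simp only [mem_Ico] at *
    exact sq_le_sq' (by linarith) (by linarith)
  refine abs_le_of_sq_le_sq' ?_ (by positivity) |>.2
  rw [EuclideanSpace.norm_sq_eq, Fin.sum_univ_two]
  simp only [PiLp.sub_apply, Real.norm_eq_abs, sq_abs]
  nlinarith [key 0, key 1]

theorem mem_cell_iff {h : ℝ} (hh : 0 < h) {n : Fin 2 → ℤ} {x : Plane} :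
    x ∈ cell h n ↔ ∀ i, ⌊x i / h⌋ = n i := by
  refine forall_congr' fun i => ?_
  rw [Int.floor_eq_iff, le_div_iff₀ hh, div_lt_iff₀ hh, mem_Ico, mul_comm h, mul_comm h]

theorem disjoint_cell {h : ℝ} (hh : 0 < h) {m n : Fin 2 → ℤ} (hmn : m ≠ n) :
    Disjoint (cell h m) (cell h n) := by
  refine Set.disjoint_left.2 fun x hm hn => hmn (funext fun i => ?_)
  rw [← (mem_cell_iff hh).1 hm i, (mem_cell_iff hh).1 hn i]

theorem exists_finset_closedBall_subset_cell {h : ℝ} (hh : 0 < h) (R : ℝ) :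
    ∃ F : Finset (Fin 2 → ℤ), Metric.closedBall (0 : Plane) R ⊆ ⋃ n ∈ F, cell h n := by
  refine ⟨Fintype.piFinset fun _ => Finset.Icc ⌊-R / h⌋ ⌊R / h⌋, fun x hx => ?_⟩
  simp only [mem_iUnion, exists_prop]
  refine ⟨fun i => ⌊x i / h⌋, ?_, (mem_cell_iff hh).2 fun i => rfl⟩
  rw [Fintype.mem_piFinset]
  intro i
  have h1 : |x i| ≤ R := by
    rw [← Real.norm_eq_abs]
    exact (PiLp.norm_apply_le x i).trans (by simpa using hx)
  rw [Finset.mem_Icc]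
  constructor <;> refine Int.floor_le_floor ?_ <;> gcongr
  · exact (abs_le.1 h1).1
  · exact (abs_le.1 h1).2

theorem add_sq_le_four_mul (a b : ℝ≥0∞) : (a + b) ^ 2 ≤ 4 * (a ^ 2 + b ^ 2) := by
  rcases le_total a b with h | h
  · calc (a + b) ^ 2 ≤ (b + b) ^ 2 := by gcongr
      _ = 4 * b ^ 2 := by ring
      _ ≤ _ := by gcongr; exact le_add_self
  · calc (a + b) ^ 2 ≤ (a + a) ^ 2 := by gcongr
      _ = 4 * a ^ 2 := by ring
      _ ≤ _ := by gcongr; exact le_self_add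

/-- For a compactly supported measure of linear growth, the embedding of the Sobolev space is
compact: the trace is small compared with the gradient once finitely many mean values vanish. -/
theorem lintegral_enorm_sq_le_of_linearGrowth {η : Measure Plane} (hη : HasLinearGrowth η) {R : ℝ}
    (hR : η (Metric.closedBall 0 R)ᶜ = 0) {κ : ℝ} (hκ : 0 < κ) :
    ∃ h > 0, ∃ F : Finset (Fin 2 → ℤ), ∃ C : ℝ≥0, ∀ φ : Plane → ℂ, ContDiff ℝ 1 φ →
      ∫⁻ x, ‖φ x‖ₑ ^ 2 ∂η ≤ ENNReal.ofReal κ * (∫⁻ x, ‖fderiv ℝ φ x‖ₑ ^ 2) +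
        C * ∑ n ∈ F, ‖∫ x in cell h n, φ x‖ₑ ^ 2 := by
  have := hη.isFiniteMeasureOnCompacts
  obtain ⟨K, hK⟩ := hη
  set h : ℝ := κ / (128 * (K + 1))
  have hh : 0 < h := by positivity
  obtain ⟨F, hF⟩ := exists_finset_closedBall_subset_cell hh R
  refine ⟨h, hh, F, 4 * (K * (2 * h).toNNReal) * ((h ^ 2)⁻¹ ^ 2).toNNReal, fun φ hφ => ?_⟩
  have hvol : ∀ n, (volume (cell h n)).toReal = h ^ 2 := fun n => by
    rw [volume_cell hh, ENNReal.toReal_ofReal (by positivity)]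
  have hcell : ∀ n, ∫⁻ x in cell h n, ‖φ x‖ₑ ^ 2 ∂η ≤
      ENNReal.ofReal κ * (∫⁻ x in cell h n, ‖fderiv ℝ φ x‖ₑ ^ 2) +
        (4 * (K * (2 * h).toNNReal) * ((h ^ 2)⁻¹ ^ 2).toNNReal : ℝ≥0) *
          ‖∫ x in cell h n, φ x‖ₑ ^ 2 := fun n => by
    set a : ℂ := ⨍ y in cell h n, φ y
    have h1 := setLIntegral_sub_average_sq_le hK (measurableSet_cell h n) (convex_cell h n)
      (d := 2 * h) (by positivity) (fun x hx y hy => norm_sub_le_of_mem_cell hh hx hy)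
      (by rw [volume_cell hh]; simpa using hh.ne') (by rw [volume_cell hh]; simp) hφ
    have h2 : η (cell h n) ≤ K * ENNReal.ofReal (2 * h) := by
      rcases (cell h n).eq_empty_or_nonempty with h0 | ⟨z, hz⟩
      · simp [h0]
      · refine (measure_mono fun x hx => ?_).trans (hK z _ (by positivity))
        rw [Metric.mem_closedBall, dist_eq_norm]
        exact norm_sub_le_of_mem_cell hh hz hx
    have h3 : ‖a‖ₑ ^ 2 = ENNReal.ofReal ((h ^ 2)⁻¹ ^ 2) * ‖∫ x in cell h n, φ x‖ₑ ^ 2 := by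
      simp only [a]
      rw [setAverage_eq, measureReal_def, hvol, enorm_smul, mul_pow, Real.enorm_of_nonneg
        (by positivity), ENNReal.ofReal_pow (by positivity)]
    have h4 : 4 * ((volume (cell h n))⁻¹ * (4 * K * ENNReal.ofReal (2 * h) ^ 3)) ≤
        ENNReal.ofReal κ := by
      rw [volume_cell hh, ← ENNReal.ofReal_inv_of_pos (by positivity),
        ← ENNReal.ofReal_pow (by positivity), ← ENNReal.ofReal_coe_nnreal,
        show (4 : ℝ≥0∞) = ENNReal.ofReal 4 by norm_num, ← ENNReal.ofReal_mul (by norm_num),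
        ← ENNReal.ofReal_mul (by positivity), ← ENNReal.ofReal_mul (by positivity),
        ← ENNReal.ofReal_mul (by norm_num)]
      refine ENNReal.ofReal_le_ofReal ?_
      have e : 4 * ((h ^ 2)⁻¹ * (4 * K * (2 * h) ^ 3)) = 128 * K * h := by
        field_simp
        ring
      rw [e]
      have e2 : 128 * (K + 1) * h = κ := by
        simp only [h]
        field_simp
      nlinarith
    calc ∫⁻ x in cell h n, ‖φ x‖ₑ ^ 2 ∂η
        ≤ ∫⁻ x in cell h n, 4 * (‖φ x - a‖ₑ ^ 2 + ‖a‖ₑ ^ 2) ∂η := by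
          refine lintegral_mono fun x => le_trans ?_ (add_sq_le_four_mul _ _)
          gcongr
          simpa using enorm_add_le (φ x - a) a
      _ = 4 * (∫⁻ x in cell h n, ‖φ x - a‖ₑ ^ 2 ∂η) + 4 * (‖a‖ₑ ^ 2 * η (cell h n)) := by
          have := hφ.continuous
          rw [lintegral_const_mul _ (by fun_prop), lintegral_add_right _ measurable_const,
            setLIntegral_const, mul_add]
      _ ≤ 4 * ((volume (cell h n))⁻¹ * (4 * K * ENNReal.ofReal (2 * h) ^ 3) *
            ∫⁻ x in cell h n, ‖fderiv ℝ φ x‖ₑ ^ 2) +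
          4 * (‖a‖ₑ ^ 2 * (K * ENNReal.ofReal (2 * h))) := by
          gcongr
      _ ≤ _ := by
          rw [← mul_assoc, h3]
          refine add_le_add (mul_le_mul' h4 le_rfl) (le_of_eq ?_)
          push_cast
          simp only [ENNReal.ofReal]
          ring
  calc ∫⁻ x, ‖φ x‖ₑ ^ 2 ∂η ≤ ∫⁻ x in ⋃ n ∈ F, cell h n, ‖φ x‖ₑ ^ 2 ∂η := by
        rw [← lintegral_add_compl (μ := η) (fun x => ‖φ x‖ₑ ^ 2)
          (Metric.isClosed_closedBall (x := (0 : Plane)) (ε := R)).measurableSet,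
          setLIntegral_measure_zero _ _ hR, add_zero]
        exact lintegral_mono_set hF
    _ = ∑ n ∈ F, ∫⁻ x in cell h n, ‖φ x‖ₑ ^ 2 ∂η :=
        lintegral_biUnion_finset (fun m _ n _ hmn => disjoint_cell hh hmn)
          (fun n _ => measurableSet_cell h n) _
    _ ≤ ∑ n ∈ F, (ENNReal.ofReal κ * (∫⁻ x in cell h n, ‖fderiv ℝ φ x‖ₑ ^ 2) +
        (4 * (K * (2 * h).toNNReal) * ((h ^ 2)⁻¹ ^ 2).toNNReal : ℝ≥0) *
          ‖∫ x in cell h n, φ x‖ₑ ^ 2) := Finset.sum_le_sum fun n _ => hcell n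
    _ ≤ _ := by
        rw [Finset.sum_add_distrib, ← Finset.mul_sum, ← Finset.mul_sum,
          ← lintegral_biUnion_finset (fun m _ n _ hmn => disjoint_cell hh hmn)
            (fun n _ => measurableSet_cell h n)]
        gcongr
        exact Measure.restrict_le_self

end LeakyWire

/-! ### The geometry of the support -/

namespace LeakyWire

open scoped ENNReal NNReal

theorem HasLinearGrowth.mono {η ν : Measure Plane} (hη : HasLinearGrowth η) (h : ν ≤ η) :
    HasLinearGrowth ν := by
  obtain ⟨K, hK⟩ := hη
  exact ⟨K, fun z r hr => (h _).trans (hK z r hr)⟩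

theorem HasLinearGrowth.sum {ι : Type*} (s : Finset ι) {η : ι → Measure Plane}
    (h : ∀ i, HasLinearGrowth (η i)) : HasLinearGrowth (∑ i ∈ s, η i) := by
  choose K hK using h
  refine ⟨∑ i ∈ s, K i, fun z r hr => ?_⟩
  rw [Measure.finsetSum_apply, ENNReal.ofNNReal_finsetSum, Finset.sum_mul]
  exact Finset.sum_le_sum fun i _ => hK i z r hr

/-- A set of linear growth arises from a map that does not increase distances, and does not
decrease them by more than a fixed factor. -/
theorem hasLinearGrowth_image {c : ℝ → Plane} {S : Set ℝ} (hc : LipschitzOnWith 1 c S) {C : ℝ}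
    (hC : 0 < C) (hinv : ∀ s ∈ S, ∀ t ∈ S, C * |s - t| ≤ ‖c s - c t‖) :
    HasLinearGrowth ((μH[1] : Measure Plane).restrict (c '' S)) := by
  refine ⟨(2 / C).toNNReal, fun z r hr => ?_⟩
  rw [Measure.restrict_apply Metric.isClosed_closedBall.measurableSet]
  have hsub : Metric.closedBall z r ∩ c '' S ⊆ c '' (S ∩ c ⁻¹' Metric.closedBall z r) := by
    rintro _ ⟨hx, s, hs, rfl⟩
    exact ⟨s, ⟨hs, hx⟩, rfl⟩
  have h1 := (hc.mono inter_subset_left :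
    LipschitzOnWith 1 c (S ∩ c ⁻¹' Metric.closedBall z r)).hausdorffMeasure_image_le
      (d := 1) zero_le_one
  rw [hausdorffMeasure_real] at h1
  simp only [ENNReal.coe_one, ENNReal.one_rpow, one_mul] at h1
  refine (measure_mono hsub).trans (h1.trans ((Real.volume_le_diam _).trans ?_))
  refine Metric.ediam_le fun s hs t ht => ?_
  have h2 : ‖c s - c t‖ ≤ 2 * r := by
    rw [← dist_eq_norm]
    linarith [dist_triangle_right (c s) (c t) z, Metric.mem_closedBall.1 hs.2,
      Metric.mem_closedBall.1 ht.2]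
  rw [edist_dist, Real.dist_eq]
  change _ ≤ ENNReal.ofReal (2 / C) * ENNReal.ofReal r
  rw [← ENNReal.ofReal_mul (by positivity)]
  refine ENNReal.ofReal_le_ofReal ?_
  rw [div_mul_eq_mul_div, le_div_iff₀ hC]
  linarith [hinv s hs.1 t ht.1]

theorem IsC1Arc.hasLinearGrowth {A : Set Plane} (hA : IsC1Arc A) :
    HasLinearGrowth ((μH[1] : Measure Plane).restrict A) := by
  obtain ⟨L, I, c, -, hI1, hI2, rfl, -, hc1, hc2, C, hC, hinv⟩ := hA
  have hlip : LipschitzOnWith 1 c (Ioo 0 L) := by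
    refine Convex.lipschitzOnWith_of_nnnorm_deriv_le (fun s hs => ?_) (fun s hs => ?_)
      (convex_Ioo 0 L)
    · exact (hc1.differentiableOn one_ne_zero s hs).differentiableAt (isOpen_Ioo.mem_nhds hs)
    · exact (NNReal.coe_le_coe.1 (by simp [hc2 s hs]))
  refine (hasLinearGrowth_image hlip hC fun s hs t ht => hinv s (hI1 hs) t (hI1 ht)).mono ?_
  -- The endpoints of the arc carry no length.
  have : NullSingletonClass (μH[1] : Measure Plane) :=
    Measure.nullSingletonClass_hausdorff _ one_pos
  refine Measure.restrict_mono_ae ?_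
  have h0 : (μH[1] : Measure Plane) {c 0, c L} = 0 := (Set.toFinite _).measure_zero _
  filter_upwards [compl_mem_ae_iff.2 h0] with x hx hxA
  obtain ⟨s, hs, rfl⟩ := hxA
  have hs2 := hI2 hs
  simp only [mem_compl_iff, mem_insert_iff, mem_singleton_iff, not_or] at hx
  exact ⟨s, ⟨lt_of_le_of_ne hs2.1 fun h => hx.1 (by rw [h]),
    lt_of_le_of_ne hs2.2 fun h => hx.2 (by rw [h])⟩, rfl⟩

/-- The parametrization of the straight line by arc length. -/
noncomputable def linePt (s : ℝ) : Plane := !₂[s, 0]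

theorem isometry_linePt : Isometry linePt := by
  refine Isometry.of_dist_eq fun s t => ?_
  simp [linePt, EuclideanSpace.dist_eq, Real.sqrt_sq_eq_abs, Real.dist_eq]

theorem range_linePt : range linePt = straightLine := by
  ext x
  refine ⟨?_, fun hx => ⟨x 0, ?_⟩⟩
  · rintro ⟨s, rfl⟩
    simp [linePt, straightLine]
  · ext i
    fin_cases i
    · simp [linePt]
    · simpa [linePt] using (show x 1 = 0 from hx).symm

theorem arcMeasure_straightLine : arcMeasure straightLine = Measure.map linePt volume := by
  rw [← hausdorffMeasure_real, isometry_linePt.map_hausdorffMeasure (Or.inl zero_le_one),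
    range_linePt, arcMeasure]

theorem hasLinearGrowth_straightLine : HasLinearGrowth (arcMeasure straightLine) := by
  have := hasLinearGrowth_image (S := univ) isometry_linePt.lipschitz.lipschitzOnWith one_pos
    fun s _ t _ => by rw [one_mul, ← dist_eq_norm, isometry_linePt.dist_eq, Real.dist_eq]
  rwa [image_univ, range_linePt] at this

theorem isCompactDeformation_straightLine : IsCompactDeformation straightLine where
  measurableSet := by
    rw [← range_linePt]
    exact isometry_linePt.isClosedEmbedding.isClosed_range.measurableSet
  eq_outside_compact := ⟨∅, isCompact_empty, rfl⟩
  arcs := ⟨0, Fin.elim0, fun i => i.elim0, by simp⟩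

namespace IsCompactDeformation

variable {Γ : Set Plane}

theorem hasLinearGrowth_sdiff (hΓ : IsCompactDeformation Γ) :
    HasLinearGrowth (arcMeasure (Γ \ straightLine)) := by
  obtain ⟨N, A, hA, hΓA⟩ := hΓ.arcs
  refine (HasLinearGrowth.sum Finset.univ fun i => (hA i).hasLinearGrowth).mono ?_
  rw [arcMeasure, hΓA]
  refine (Measure.restrict_iUnion_le (s := A)).trans_eq ?_
  rw [Measure.sum_fintype]

theorem exists_closedBall (hΓ : IsCompactDeformation Γ) :
    ∃ R, 0 < R ∧ Γ \ Metric.closedBall 0 R = straightLine \ Metric.closedBall 0 R := by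
  obtain ⟨M, hM, h⟩ := hΓ.eq_outside_compact
  obtain ⟨R, hR, hMR⟩ := hM.isBounded.subset_closedBall_lt 0 0
  refine ⟨R, hR, ?_⟩
  have e : ∀ S : Set Plane, S \ Metric.closedBall 0 R = (S \ M) \ Metric.closedBall 0 R :=
      fun S => by
    ext x
    simp only [mem_sdiff]
    exact ⟨fun h => ⟨⟨h.1, fun hx => h.2 (hMR hx)⟩, h.2⟩, fun h => ⟨h.1.1, h.2⟩⟩
  rw [e Γ, e straightLine, h]

theorem arcMeasure_sdiff_compl_closedBall (hΓ : IsCompactDeformation Γ) :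
    ∃ R, arcMeasure (Γ \ straightLine) (Metric.closedBall 0 R)ᶜ = 0 := by
  obtain ⟨R, -, hR⟩ := hΓ.exists_closedBall
  refine ⟨R, ?_⟩
  rw [arcMeasure, Measure.restrict_apply Metric.isClosed_closedBall.measurableSet.compl]
  suffices h : (Metric.closedBall 0 R)ᶜ ∩ (Γ \ straightLine) = ∅ by rw [h, measure_empty]
  rw [eq_empty_iff_forall_notMem]
  rintro x ⟨hx, hxΓ, hxl⟩
  have : x ∈ Γ \ Metric.closedBall 0 R := ⟨hxΓ, hx⟩
  rw [hR] at this
  exact hxl this.1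

theorem arcMeasure_le (Γ : Set Plane) :
    arcMeasure Γ ≤ arcMeasure straightLine + arcMeasure (Γ \ straightLine) := by
  refine (Measure.restrict_mono_set _ ?_).trans (Measure.restrict_union_le _ _)
  rw [union_sdiff_self]
  exact subset_union_right

theorem isFiniteMeasureOnCompacts (hΓ : IsCompactDeformation Γ) :
    IsFiniteMeasureOnCompacts (arcMeasure Γ) := by
  have h1 := hasLinearGrowth_straightLine.isFiniteMeasureOnCompacts
  have h2 := hΓ.hasLinearGrowth_sdiff.isFiniteMeasureOnCompacts
  refine ⟨fun K hK => (arcMeasure_le Γ K).trans_lt ?_⟩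
  rw [Measure.add_apply]
  exact ENNReal.add_lt_top.2 ⟨hK.measure_lt_top, hK.measure_lt_top⟩

end IsCompactDeformation

end LeakyWire

/-! ### The sharp trace inequality on the straight line -/

namespace LeakyWire

open scoped ENNReal NNReal

theorem hasCompactSupport_norm_sq {X : Type*} [TopologicalSpace X] {g : X → ℂ}
    (hs : HasCompactSupport g) : HasCompactSupport fun t => ‖g t‖ ^ 2 :=
  hs.mono fun t ht h => ht (by simp [h])

/-- The sharp trace inequality in one dimension; `exp (-β |t| / 2)` is the case of equality. -/
theorem mul_norm_sq_le_integral {g : ℝ → ℂ} (hg : ContDiff ℝ 1 g) (hs : HasCompactSupport g)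
    {β : ℝ} (hβ : 0 < β) :
    β * ‖g 0‖ ^ 2 ≤ (∫ t, ‖deriv g t‖ ^ 2) + β ^ 2 / 4 * ∫ t, ‖g t‖ ^ 2 := by
  set f : ℝ → ℝ := fun t => ‖g t‖ ^ 2
  have hf : ContDiff ℝ 1 f := hg.norm_sq ℂ
  have hfs : HasCompactSupport f := hasCompactSupport_norm_sq hs
  have hgd : Continuous (deriv g) := hg.continuous_deriv le_rfl
  have hgs : HasCompactSupport (deriv g) := hs.deriv
  have hder : ∀ t, ‖deriv f t‖ ≤ 2 / β * ‖deriv g t‖ ^ 2 + β / 2 * ‖g t‖ ^ 2 := fun t => by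
    rw [((hg.differentiable one_ne_zero t).hasDerivAt.norm_sq).deriv, norm_mul]
    have h1 : ‖inner ℝ (g t) (deriv g t)‖ ≤ ‖g t‖ * ‖deriv g t‖ := norm_inner_le_norm _ _
    have h2 : 2 / β * ‖deriv g t‖ ^ 2 + β / 2 * ‖g t‖ ^ 2 - 2 * (‖g t‖ * ‖deriv g t‖) =
        (2 * ‖deriv g t‖ - β * ‖g t‖) ^ 2 / (2 * β) := by
      field_simp
      ring
    have h3 : 0 ≤ (2 * ‖deriv g t‖ - β * ‖g t‖) ^ 2 / (2 * β) := by positivity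
    rw [Real.norm_of_nonneg zero_le_two]
    linarith
  have i1 : Integrable fun t => ‖deriv g t‖ ^ 2 :=
    (hgd.norm.pow 2).integrable_of_hasCompactSupport
      (hasCompactSupport_norm_sq hgs)
  have i2 : Integrable fun t => ‖g t‖ ^ 2 :=
    (hg.continuous.norm.pow 2).integrable_of_hasCompactSupport hfs
  have i3 : Integrable (deriv f) :=
    (hf.continuous_deriv le_rfl).integrable_of_hasCompactSupport hfs.deriv
  have h1 : f 0 ≤ ∫ t in Iic 0, ‖deriv f t‖ := by
    rw [← hfs.integral_Iic_deriv_eq hf 0]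
    exact (Real.le_norm_self _).trans (norm_integral_le_integral_norm _)
  have h2 : f 0 ≤ ∫ t in Ioi 0, ‖deriv f t‖ := by
    have := norm_integral_le_integral_norm (μ := volume.restrict (Ioi 0)) (deriv f)
    rw [hfs.integral_Ioi_deriv_eq hf 0, norm_neg] at this
    exact (Real.le_norm_self _).trans this
  have h3 : (∫ t in Iic 0, ‖deriv f t‖) + ∫ t in Ioi 0, ‖deriv f t‖ = ∫ t, ‖deriv f t‖ := by
    rw [← compl_Iic]
    exact integral_add_compl measurableSet_Iic i3.norm
  have h4 : ∫ t, ‖deriv f t‖ ≤ ∫ t, (2 / β * ‖deriv g t‖ ^ 2 + β / 2 * ‖g t‖ ^ 2) :=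
    integral_mono i3.norm ((i1.const_mul _).add (i2.const_mul _)) hder
  rw [integral_add (i1.const_mul _) (i2.const_mul _), integral_const_mul, integral_const_mul] at h4
  have h5 : 2 * f 0 ≤ 2 / β * (∫ t, ‖deriv g t‖ ^ 2) + β / 2 * ∫ t, ‖g t‖ ^ 2 := by linarith
  have h6 := mul_le_mul_of_nonneg_left h5 (by positivity : 0 ≤ β / 2)
  have h7 : β / 2 * (2 / β * (∫ t, ‖deriv g t‖ ^ 2) + β / 2 * ∫ t, ‖g t‖ ^ 2) =
      (∫ t, ‖deriv g t‖ ^ 2) + β ^ 2 / 4 * ∫ t, ‖g t‖ ^ 2 := by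
    field_simp
    ring
  change β * f 0 ≤ _
  linarith

theorem lintegral_enorm_sq_eq {X : Type*} [TopologicalSpace X] [MeasurableSpace X]
    [OpensMeasurableSpace X] {μ : Measure X} [IsFiniteMeasureOnCompacts μ] {g : X → ℂ}
    (hg : Continuous g) (hs : HasCompactSupport g) :
    ∫⁻ t, ‖g t‖ₑ ^ 2 ∂μ = ENNReal.ofReal (∫ t, ‖g t‖ ^ 2 ∂μ) := by
  rw [ofReal_integral_eq_lintegral_ofReal]
  · simp only [ENNReal.ofReal_pow (norm_nonneg _), ofReal_norm]
  · exact (hg.norm.pow 2).integrable_of_hasCompactSupport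
      (hasCompactSupport_norm_sq hs)
  · exact Filter.Eventually.of_forall fun t => sq_nonneg _

theorem mul_enorm_sq_le_lintegral {g : ℝ → ℂ} (hg : ContDiff ℝ 1 g) (hs : HasCompactSupport g)
    {β : ℝ} (hβ : 0 < β) : ENNReal.ofReal β * ‖g 0‖ₑ ^ 2 ≤
      (∫⁻ t, ‖deriv g t‖ₑ ^ 2) + ENNReal.ofReal (β ^ 2 / 4) * ∫⁻ t, ‖g t‖ₑ ^ 2 := by
  rw [lintegral_enorm_sq_eq (hg.continuous_deriv le_rfl) hs.deriv,
    lintegral_enorm_sq_eq hg.continuous hs, ← ofReal_norm,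
    ← ENNReal.ofReal_pow (norm_nonneg _), ← ENNReal.ofReal_mul hβ.le,
    ← ENNReal.ofReal_mul (by positivity), ← ENNReal.ofReal_add (by positivity) (by positivity)]
  exact ENNReal.ofReal_le_ofReal (mul_norm_sq_le_integral hg hs hβ)

/-- The point of the plane with given coordinates. -/
def planePt (s t : ℝ) : Plane := !₂[s, t]

theorem planePt_eq (s t : ℝ) : planePt s t =
    s • EuclideanSpace.single 0 1 + t • EuclideanSpace.single 1 1 := by
  ext i
  fin_cases i <;> simp [planePt]

theorem continuous_planePt : Continuous fun p : ℝ × ℝ => planePt p.1 p.2 := by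
  simp only [planePt_eq]
  fun_prop

theorem lintegral_plane {f : Plane → ℝ≥0∞} (hf : Measurable f) :
    ∫⁻ x, f x = ∫⁻ s, ∫⁻ t, f (planePt s t) := by
  have h1 : MeasurePreserving (fun p : ℝ × ℝ => planePt p.1 p.2) volume volume := by
    have := (PiLp.volume_preserving_toLp (Fin 2)).comp (volume_preserving_finTwoArrow ℝ).symm
    convert! this using 1
  rw [← h1.lintegral_comp hf]
  exact lintegral_prod _ (hf.comp h1.measurable).aemeasurable

theorem hasDerivAt_planePt_snd {φ : Plane → ℂ} (hφ : Differentiable ℝ φ) (s t : ℝ) :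
    HasDerivAt (fun t => φ (planePt s t)) (partialDeriv 1 φ (planePt s t)) t := by
  have h1 : HasDerivAt (fun t => planePt s t) (EuclideanSpace.single 1 1) t := by
    simp only [planePt_eq]
    simpa using ((hasDerivAt_id t).smul_const (EuclideanSpace.single (1 : Fin 2) (1 : ℝ))).const_add
      (s • EuclideanSpace.single 0 1)
  exact (hφ _).hasFDerivAt.comp_hasDerivAt t h1

theorem isometry_planePt (s : ℝ) : Isometry (planePt s) := by
  refine Isometry.of_dist_eq fun t u => ?_
  simp [planePt, EuclideanSpace.dist_eq, Real.sqrt_sq_eq_abs, Real.dist_eq]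

theorem lintegral_arcMeasure_straightLine {f : Plane → ℝ≥0∞} (hf : Measurable f) :
    ∫⁻ x, f x ∂(arcMeasure straightLine) = ∫⁻ s, f (planePt s 0) := by
  rw [arcMeasure_straightLine, lintegral_map hf isometry_linePt.continuous.measurable]
  rfl

/-- The trace inequality on the straight line with the sharp constant: apply the one-dimensional
inequality on each normal line. -/
theorem mul_lintegral_straightLine_le {φ : Plane → ℂ} (hφ : IsTestFunction φ) {β : ℝ}
    (hβ : 0 < β) : ENNReal.ofReal β * ∫⁻ x, ‖φ x‖ₑ ^ 2 ∂(arcMeasure straightLine) ≤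
      (∫⁻ x, ‖partialDeriv 1 φ x‖ₑ ^ 2) + ENNReal.ofReal (β ^ 2 / 4) * ∫⁻ x, ‖φ x‖ₑ ^ 2 := by
  have hc := hφ.1.continuous
  have hd := hφ.continuous_partialDeriv 1
  have hp : ∀ s, ContDiff ℝ 1 (fun t => φ (planePt s t)) := fun s => by
    have h1 : ContDiff ℝ 1 (planePt s) := by
      rw [show planePt s = fun t => s • EuclideanSpace.single 0 1 + t • EuclideanSpace.single 1 1
        from funext (planePt_eq s)]
      fun_prop
    exact (hφ.1.of_le (by simp)).comp h1
  have hm : Measurable fun p : ℝ × ℝ => ‖φ (planePt p.1 p.2)‖ₑ ^ 2 :=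
    (hc.comp continuous_planePt).measurable.enorm.pow_const 2
  have hm' : Measurable fun p : ℝ × ℝ => ‖partialDeriv 1 φ (planePt p.1 p.2)‖ₑ ^ 2 :=
    (hd.comp continuous_planePt).measurable.enorm.pow_const 2
  rw [lintegral_arcMeasure_straightLine (hc.measurable.enorm.pow_const 2),
    lintegral_plane (hc.measurable.enorm.pow_const 2),
    lintegral_plane (hd.measurable.enorm.pow_const 2),
    ← lintegral_const_mul _ hm.lintegral_prod_right', ← lintegral_add_right _
      (hm.lintegral_prod_right'.const_mul _)]
  · have hc0 : Continuous fun s => φ (planePt s 0) := hc.comp isometry_linePt.continuous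
    have hm0 : Measurable fun s => ‖φ (planePt s 0)‖ₑ ^ 2 := hc0.measurable.enorm.pow_const 2
    rw [← lintegral_const_mul _ hm0]
    refine lintegral_mono fun s => ?_
    have hcs : HasCompactSupport fun t => φ (planePt s t) :=
      hφ.2.comp_isClosedEmbedding (isometry_planePt s).isClosedEmbedding
    have h1 := mul_enorm_sq_le_lintegral (hp s) hcs hβ
    have h2 : deriv (fun t => φ (planePt s t)) = fun t => partialDeriv 1 φ (planePt s t) :=
      funext fun t => (hasDerivAt_planePt_snd (hφ.1.differentiable (by simp)) s t).deriv
    rw [h2] at h1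
    exact h1

/-! ### The trace bound for compact deformations -/

theorem enorm_sq_eq_lintegral {η : Measure Plane} {u : Lp ℂ 2 η} {φ : Plane → ℂ}
    (h : u =ᵐ[η] φ) : ENNReal.ofReal (‖u‖ ^ 2) = ∫⁻ x, ‖φ x‖ₑ ^ 2 ∂η := by
  have h1 := eLpNorm_nnreal_pow_eq_lintegral (μ := η) (f := u) (p := 2) two_ne_zero
  rw [ENNReal.ofReal_pow (norm_nonneg _), ofReal_norm, Lp.enorm_def]
  simp only [ENNReal.coe_ofNat, NNReal.coe_ofNat, ENNReal.rpow_ofNat] at h1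
  rw [h1]
  exact lintegral_congr_ae (h.mono fun x hx => by simp only [hx])

theorem enorm_fderiv_sq_le (φ : Plane → ℂ) (x : Plane) :
    ‖fderiv ℝ φ x‖ₑ ^ 2 ≤ ∑ i, ‖partialDeriv i φ x‖ₑ ^ 2 := by
  have h1 : ‖fderiv ℝ φ x‖ ≤ √(∑ i, ‖partialDeriv i φ x‖ ^ 2) := by
    refine ContinuousLinearMap.opNorm_le_bound _ (Real.sqrt_nonneg _) fun v => ?_
    have hv : fderiv ℝ φ x v = ∑ i, (v i : ℂ) * partialDeriv i φ x := by
      have : v = ∑ i, v i • EuclideanSpace.single i (1 : ℝ) := by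
        ext j
        fin_cases j <;> simp [Fin.sum_univ_two]
      conv_lhs => rw [this]
      simp only [map_sum, map_smul, partialDeriv, Complex.real_smul]
    rw [hv, EuclideanSpace.norm_eq v, mul_comm]
    calc ‖∑ i, (v i : ℂ) * partialDeriv i φ x‖
        ≤ ∑ i, ‖v i‖ * ‖partialDeriv i φ x‖ := by
          refine (norm_sum_le _ _).trans (Finset.sum_le_sum fun i _ => ?_)
          rw [norm_mul, Complex.norm_real]
      _ ≤ _ := Real.sum_mul_le_sqrt_mul_sqrt _ _ _
  have h2 : ‖fderiv ℝ φ x‖ ^ 2 ≤ ∑ i, ‖partialDeriv i φ x‖ ^ 2 := by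
    refine (pow_le_pow_left₀ (norm_nonneg _) h1 2).trans_eq (Real.sq_sqrt ?_)
    exact Finset.sum_nonneg fun i _ => sq_nonneg _
  have h3 := ENNReal.ofReal_le_ofReal h2
  rw [ENNReal.ofReal_sum_of_nonneg fun i _ => sq_nonneg _] at h3
  simpa only [ENNReal.ofReal_pow (norm_nonneg _), ofReal_norm] using h3

theorem norm_inner_sq_le_starProjection {H : Type*} [NormedAddCommGroup H] [InnerProductSpace ℂ H]
    (E : Submodule ℂ H) [E.HasOrthogonalProjection] {e : H} (he : e ∈ E) (x : H) :
    ‖⟪e, x⟫_ℂ‖ ^ 2 ≤ ‖e‖ ^ 2 * ‖E.starProjection x‖ ^ 2 := by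
  have h1 : ⟪e, x⟫_ℂ = ⟪e, E.starProjection x⟫_ℂ := by
    conv_lhs => rw [← Submodule.starProjection_eq_self_iff.2 he]
    exact E.inner_starProjection_left_eq_right e x
  rw [h1, ← mul_pow]
  gcongr
  exact norm_inner_le_norm _ _

theorem IsCompactDeformation.hasTraceBound {Γ : Set Plane} (hΓ : IsCompactDeformation Γ) :
    HasTraceBound (arcMeasure Γ) := by
  intro β hβ ε hε
  obtain ⟨R, hR⟩ := hΓ.arcMeasure_sdiff_compl_closedBall
  obtain ⟨h, hh, F, C, hC⟩ := lintegral_enorm_sq_le_of_linearGrowth hΓ.hasLinearGrowth_sdiff hR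
    (κ := ε / β) (by positivity)
  have hfin : ∀ n, volume (cell h n) ≠ ⊤ := fun n => by rw [volume_cell hh]; simp
  set e : (Fin 2 → ℤ) → L2 := fun n =>
    indicatorConstLp 2 (measurableSet_cell h n) (hfin n) (1 : ℂ)
  set E : Submodule ℂ L2 := Submodule.span ℂ (e '' F)
  have hE : FiniteDimensional ℂ E := FiniteDimensional.span_of_finite ℂ (F.finite_toSet.image e)
  refine ⟨β * C * ∑ n ∈ F, ‖e n‖ ^ 2, by positivity, E, hE, ?_⟩
  rintro p ⟨φ, hφ, h1, h2, h3⟩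
  have a1 := mul_lintegral_straightLine_le hφ hβ
  have a2 := hC φ (hφ.1.of_le (by simp))
  have a3 : ∫⁻ x, ‖φ x‖ₑ ^ 2 ∂(arcMeasure Γ) ≤ ∫⁻ x, ‖φ x‖ₑ ^ 2 ∂(arcMeasure straightLine) +
      ∫⁻ x, ‖φ x‖ₑ ^ 2 ∂(arcMeasure (Γ \ straightLine)) := by
    rw [← lintegral_add_measure]
    exact lintegral_mono' (arcMeasure_le Γ) le_rfl
  have a4 : ∫⁻ x, ‖fderiv ℝ φ x‖ₑ ^ 2 ≤ ENNReal.ofReal (∑ i, ‖p.2.1 i‖ ^ 2) := by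
    rw [ENNReal.ofReal_sum_of_nonneg fun i _ => sq_nonneg _]
    simp only [enorm_sq_eq_lintegral (h2 _)]
    rw [← lintegral_finsetSum _ fun i _ =>
      (hφ.continuous_partialDeriv i).measurable.enorm.pow_const 2]
    exact lintegral_mono (enorm_fderiv_sq_le φ)
  have a5 : ∑ n ∈ F, ‖∫ x in cell h n, φ x‖ₑ ^ 2 ≤
      ENNReal.ofReal ((∑ n ∈ F, ‖e n‖ ^ 2) * ‖E.starProjection p.1‖ ^ 2) := by
    rw [Finset.sum_mul, ENNReal.ofReal_sum_of_nonneg fun i _ => by positivity]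
    refine Finset.sum_le_sum fun n hn => ?_
    have e1 : ∫ x in cell h n, φ x = ⟪e n, p.1⟫_ℂ := by
      rw [L2.inner_indicatorConstLp_one]
      exact integral_congr_ae (ae_restrict_of_ae (h1.mono fun x hx => hx.symm))
    rw [e1, ← ofReal_norm, ← ENNReal.ofReal_pow (norm_nonneg _)]
    exact ENNReal.ofReal_le_ofReal (norm_inner_sq_le_starProjection E
      (Submodule.subset_span (mem_image_of_mem e hn)) p.1)
  have a6 : ∫⁻ x, ‖partialDeriv 1 φ x‖ₑ ^ 2 ≤ ENNReal.ofReal (∑ i, ‖p.2.1 i‖ ^ 2) := by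
    rw [← enorm_sq_eq_lintegral (h2 1)]
    exact ENNReal.ofReal_le_ofReal (Finset.single_le_sum (f := fun i => ‖p.2.1 i‖ ^ 2)
      (fun i _ => sq_nonneg _) (Finset.mem_univ 1))
  rw [← enorm_sq_eq_lintegral h3] at a3
  rw [← enorm_sq_eq_lintegral h1] at a1
  set S := ∑ i, ‖p.2.1 i‖ ^ 2
  have hS : 0 ≤ S := Finset.sum_nonneg fun i _ => sq_nonneg _
  set P := (∑ n ∈ F, ‖e n‖ ^ 2) * ‖E.starProjection p.1‖ ^ 2
  have hP : 0 ≤ P := by positivity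
  have key : ENNReal.ofReal (β * ‖p.2.2‖ ^ 2) ≤
      ENNReal.ofReal (S + β ^ 2 / 4 * ‖p.1‖ ^ 2 + β * (ε / β * S + C * P)) := by
    calc ENNReal.ofReal (β * ‖p.2.2‖ ^ 2) = ENNReal.ofReal β * ENNReal.ofReal (‖p.2.2‖ ^ 2) :=
          ENNReal.ofReal_mul hβ.le
      _ ≤ ENNReal.ofReal β * (∫⁻ x, ‖φ x‖ₑ ^ 2 ∂(arcMeasure straightLine) +
            ∫⁻ x, ‖φ x‖ₑ ^ 2 ∂(arcMeasure (Γ \ straightLine))) := by gcongr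
      _ = ENNReal.ofReal β * (∫⁻ x, ‖φ x‖ₑ ^ 2 ∂(arcMeasure straightLine)) +
            ENNReal.ofReal β * ∫⁻ x, ‖φ x‖ₑ ^ 2 ∂(arcMeasure (Γ \ straightLine)) := mul_add _ _ _
      _ ≤ (ENNReal.ofReal S + ENNReal.ofReal (β ^ 2 / 4) * ENNReal.ofReal (‖p.1‖ ^ 2)) +
            ENNReal.ofReal β * (ENNReal.ofReal (ε / β) * ENNReal.ofReal S +
              C * ENNReal.ofReal P) := by
          refine add_le_add (a1.trans (by gcongr)) ?_
          refine mul_le_mul' le_rfl (a2.trans ?_)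
          gcongr
      _ = _ := by
          rw [← ENNReal.ofReal_coe_nnreal, ← ENNReal.ofReal_mul (by positivity),
            ← ENNReal.ofReal_mul (by positivity), ← ENNReal.ofReal_mul (by positivity),
            ← ENNReal.ofReal_add (by positivity) (by positivity),
            ← ENNReal.ofReal_add (by positivity) (by positivity),
            ← ENNReal.ofReal_mul (by positivity),
            ← ENNReal.ofReal_add (by positivity) (by positivity)]
  have hfinal := (ENNReal.ofReal_le_ofReal_iff (by positivity)).1 key
  refine hfinal.trans_eq ?_
  simp only [P]
  field_simp
  ring

end LeakyWire

/-! ### Approximate eigenfunctions -/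

namespace LeakyWire

theorem integral_exp_neg_mul_abs {b : ℝ} (hb : 0 < b) :
    Integrable (fun t : ℝ => Real.exp (-b * |t|)) ∧ ∫ t : ℝ, Real.exp (-b * |t|) = 2 / b := by
  have h1 : ∫ t : ℝ, Real.exp (-b * |t|) = 2 / b := by
    rw [integral_comp_abs (f := fun t => Real.exp (-b * t)), integral_exp_mul_Ioi (by linarith)]
    simp
    field_simp
  refine ⟨?_, h1⟩
  by_contra h
  rw [integral_undef h] at h1
  have : 0 < 2 / b := by positivity
  exact this.ne h1

/-- A fixed smooth cutoff function, equal to `1` on `[-1, 1]`, with compact support. -/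
theorem exists_cutoff : ∃ ρ : ℝ → ℝ, ContDiff ℝ ∞ ρ ∧ (∀ t, 2 ≤ |t| → ρ t = 0) ∧
    (∀ t, |t| ≤ 1 → ρ t = 1) ∧ (∀ t, 0 ≤ ρ t) ∧ (∀ t, ρ t ≤ 1) ∧ HasCompactSupport ρ ∧
    ∃ c, 0 ≤ c ∧ ∀ t, |deriv ρ t| ≤ c := by
  let f : ContDiffBump (0 : ℝ) := ⟨1, 2, one_pos, one_lt_two⟩
  obtain ⟨c, hc⟩ := f.hasCompactSupport.deriv.exists_bound_of_continuous
    ((f.contDiff (n := 1)).continuous_deriv le_rfl)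
  refine ⟨f, f.contDiff, fun t ht => f.zero_of_le_dist (by simpa [Real.dist_eq] using ht),
    fun t ht => f.one_of_mem_closedBall (by simpa [Real.dist_eq] using ht),
    fun t => f.nonneg, fun t => f.le_one, f.hasCompactSupport, c,
    (norm_nonneg _).trans (hc 0), hc⟩

/-- The smooth profile `exp (-κ √(t² + x²))`, cut off at distance of order `1 / x`, almost
saturates the one-dimensional trace inequality as `x → 0`. -/
theorem exists_profile {κ δ : ℝ} (hκ : 0 < κ) (hδ : 0 < δ) : ∃ w : ℝ → ℂ, ContDiff ℝ ∞ w ∧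
    HasCompactSupport w ∧ 0 < ∫ t, ‖w t‖ ^ 2 ∧
    (∫ t, ‖deriv w t‖ ^ 2) + κ ^ 2 * (∫ t, ‖w t‖ ^ 2) ≤
      2 * κ * ‖w 0‖ ^ 2 + δ * ∫ t, ‖w t‖ ^ 2 := by
  obtain ⟨ρ, hρ, hρ0, hρ1, hρn, hρl, -, c, hc0, hc⟩ := exists_cutoff
  set m : ℝ := 2 * Real.exp (-4 * κ)
  have hm : 0 < m := by positivity
  -- The excess `F x` of the profile with parameter `x` tends to zero.
  set F : ℝ → ℝ := fun x => (c ^ 2 * x ^ 2 + 2 * c * x * κ + 2 * κ ^ 2) / κ -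
    2 * κ * Real.exp (-2 * κ * x)
  have hF : Filter.Tendsto F (nhds 0) (nhds 0) := by
    have h1 : Continuous F := by fun_prop
    have h2 : F 0 = 0 := by
      simp only [F]
      field_simp
      simp
    simpa [h2] using h1.tendsto 0
  obtain ⟨x, hxF, hx0, hx1⟩ : ∃ x, F x < δ * m ∧ 0 < x ∧ x < 1 := by
    have h1 : ∀ᶠ x in nhdsWithin 0 (Ioi 0), F x < δ * m :=
      (hF.mono_left nhdsWithin_le_nhds).eventually_lt_const (by positivity)
    have h2 : ∀ᶠ x in nhdsWithin (0 : ℝ) (Ioi 0), x ∈ Ioo (0 : ℝ) 1 :=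
      Ioo_mem_nhdsGT one_pos
    obtain ⟨x, h3, h4⟩ := (h1.and h2).exists
    exact ⟨x, h3, h4.1, h4.2⟩
  set r : ℝ → ℝ := fun t => √(t ^ 2 + x ^ 2)
  have hpos : ∀ t, 0 < t ^ 2 + x ^ 2 := fun t => by positivity
  have hr : ∀ t, |t| ≤ r t := fun t => Real.abs_le_sqrt (by nlinarith)
  have hr0 : ∀ t, 0 < r t := fun t => Real.sqrt_pos.2 (hpos t)
  set v : ℝ → ℝ := fun t => Real.exp (-κ * r t)
  have hv0 : ∀ t, 0 < v t := fun t => Real.exp_pos _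
  set u : ℝ → ℝ := fun t => ρ (x * t) * v t
  set u' : ℝ → ℝ := fun t => deriv ρ (x * t) * x * v t + ρ (x * t) * (v t * (-κ * (t / r t)))
  have hu : ∀ t, HasDerivAt u (u' t) t := fun t => by
    have h1 : HasDerivAt (fun t => ρ (x * t)) (deriv ρ (x * t) * x) t := by
      have h0 : HasDerivAt (fun t => x * t) x t := by
        simpa using (hasDerivAt_id t).const_mul x
      exact ((hρ.differentiable (by simp) (x * t)).hasDerivAt).comp t h0
    have h2 : HasDerivAt r (t / r t) t := by
      have := ((hasDerivAt_pow 2 t).add_const (x ^ 2)).sqrt (hpos t).ne'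
      convert! this using 1
      simp only [r]
      field_simp
      simp [mul_comm]
    exact h1.mul (h2.const_mul (-κ)).exp
  have hus : ContDiff ℝ ∞ u :=
    (hρ.comp (contDiff_const.mul contDiff_id)).mul
      ((contDiff_const.mul (ContDiff.sqrt (by fun_prop) fun t => (hpos t).ne')).exp)
  have hu0 : ∀ t, 2 / x ≤ |t| → u t = 0 := fun t ht => by
    simp only [u]
    rw [hρ0, zero_mul]
    rw [abs_mul, abs_of_pos hx0]
    rwa [div_le_iff₀' hx0] at ht
  have hcs : HasCompactSupport (fun t => (u t : ℂ)) := by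
    refine HasCompactSupport.intro (isCompact_Icc (a := -(2 / x)) (b := 2 / x)) fun t ht => ?_
    rw [hu0 t, Complex.ofReal_zero]
    by_contra h
    exact ht (abs_le.1 (not_le.1 h).le)
  have hw : ContDiff ℝ ∞ (fun t => (u t : ℂ)) := Complex.ofRealCLM.contDiff.comp hus
  have hdw : ∀ t, deriv (fun t => (u t : ℂ)) t = (u' t : ℂ) := fun t => (hu t).ofReal_comp.deriv
  obtain ⟨hei, heI⟩ := integral_exp_neg_mul_abs (b := 2 * κ) (by positivity)
  have i1 : Integrable fun t => ‖(u t : ℂ)‖ ^ 2 :=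
    (hw.continuous.norm.pow 2).integrable_of_hasCompactSupport (hasCompactSupport_norm_sq hcs)
  have i2 : Integrable fun t => ‖deriv (fun t => (u t : ℂ)) t‖ ^ 2 :=
    ((hw.continuous_deriv (by simp)).norm.pow 2).integrable_of_hasCompactSupport
      (hasCompactSupport_norm_sq hcs.deriv)
  have hmass : m ≤ ∫ t, ‖(u t : ℂ)‖ ^ 2 := by
    calc m = ∫ t in Icc (-1 : ℝ) 1, Real.exp (-4 * κ) := by
          rw [setIntegral_const]
          simp [m]
          norm_num
      _ ≤ ∫ t in Icc (-1 : ℝ) 1, ‖(u t : ℂ)‖ ^ 2 := by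
          refine setIntegral_mono_on (by simp) i1.integrableOn measurableSet_Icc fun t ht => ?_
          have ht1 : |t| ≤ 1 := abs_le.2 ht
          rw [Complex.norm_real, Real.norm_eq_abs, sq_abs]
          simp only [u, v]
          rw [hρ1 _ (by rw [abs_mul, abs_of_pos hx0]; nlinarith [abs_nonneg t]), one_mul,
            ← Real.exp_nat_mul]
          refine Real.exp_le_exp.2 ?_
          have : r t ≤ 2 := Real.sqrt_le_iff.2 ⟨by norm_num, by
            have := sq_abs t
            nlinarith [abs_nonneg t]⟩
          push_cast
          nlinarith
      _ ≤ _ := setIntegral_le_integral i1 (Filter.Eventually.of_forall fun t => sq_nonneg _)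
  have hpt : ∀ t, ‖deriv (fun t => (u t : ℂ)) t‖ ^ 2 + κ ^ 2 * ‖(u t : ℂ)‖ ^ 2 ≤
      (c ^ 2 * x ^ 2 + 2 * c * x * κ + 2 * κ ^ 2) * Real.exp (-(2 * κ) * |t|) := fun t => by
    have h0 := hρn (x * t)
    have h0' := hρl (x * t)
    have hv := hv0 t
    have h1 : |t / r t| ≤ 1 := by
      rw [abs_div, abs_of_pos (hr0 t)]
      exact div_le_one_of_le₀ (hr t) (hr0 t).le
    have h2 : |u' t| ≤ (c * x + κ * ρ (x * t)) * v t := by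
      calc |u' t| ≤ |deriv ρ (x * t)| * x * v t + ρ (x * t) * (v t * (κ * |t / r t|)) := by
            refine (abs_add_le _ _).trans_eq ?_
            simp only [abs_mul, abs_neg, abs_of_pos hx0, abs_of_pos hv, abs_of_nonneg h0,
              abs_of_pos hκ]
        _ ≤ c * x * v t + ρ (x * t) * (v t * (κ * 1)) := by
            gcongr
            exact hc _
        _ = _ := by ring
    have h3 : v t ^ 2 ≤ Real.exp (-(2 * κ) * |t|) := by
      simp only [v]
      rw [← Real.exp_nat_mul]
      refine Real.exp_le_exp.2 ?_
      push_cast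
      nlinarith [hr t]
    rw [hdw, Complex.norm_real, Complex.norm_real, Real.norm_eq_abs, Real.norm_eq_abs]
    calc |u' t| ^ 2 + κ ^ 2 * |u t| ^ 2
        ≤ ((c * x + κ * ρ (x * t)) * v t) ^ 2 + κ ^ 2 * |u t| ^ 2 := by gcongr
      _ = ((c * x + κ * ρ (x * t)) ^ 2 + κ ^ 2 * ρ (x * t) ^ 2) * v t ^ 2 := by
          rw [sq_abs]
          simp only [u]
          ring
      _ ≤ ((c * x + κ * 1) ^ 2 + κ ^ 2 * 1 ^ 2) * Real.exp (-(2 * κ) * |t|) := by gcongr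
      _ = _ := by ring
  have hint : (∫ t, ‖deriv (fun t => (u t : ℂ)) t‖ ^ 2) + κ ^ 2 * (∫ t, ‖(u t : ℂ)‖ ^ 2) ≤
      (c ^ 2 * x ^ 2 + 2 * c * x * κ + 2 * κ ^ 2) / κ := by
    rw [← integral_const_mul, ← integral_add i2 (i1.const_mul _)]
    refine (integral_mono (i2.add (i1.const_mul _)) (hei.const_mul _) hpt).trans_eq ?_
    rw [integral_const_mul, heI]
    field_simp
  have hval : ‖(u 0 : ℂ)‖ ^ 2 = Real.exp (-2 * κ * x) := by
    rw [Complex.norm_real, Real.norm_eq_abs, sq_abs]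
    simp only [u, v, r]
    rw [hρ1 _ (by simp), one_mul, ← Real.exp_nat_mul]
    congr 1
    simp [Real.sqrt_sq hx0.le]
    ring
  refine ⟨fun t => (u t : ℂ), hw, hcs, hm.trans_le hmass, ?_⟩
  rw [hval]
  have h1 : δ * m ≤ δ * ∫ t, ‖(u t : ℂ)‖ ^ 2 := by gcongr
  simp only [F] at hxF
  linarith

/-- Slowly modulated plane waves on the line, supported to the right of a given point. -/
theorem exists_modulated_wave (k R : ℝ) {δ : ℝ} (hδ : 0 < δ) : ∃ χ τ : ℝ → ℂ,
    ContDiff ℝ ∞ χ ∧ HasCompactSupport χ ∧ Continuous τ ∧ HasCompactSupport τ ∧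
    (∀ s ≤ R, χ s = 0) ∧ (∀ s, deriv χ s = Complex.I * k * χ s + τ s) ∧ 0 < ∫ s, ‖χ s‖ ^ 2 ∧
    ∫ s, ‖τ s‖ ^ 2 ≤ δ * ∫ s, ‖χ s‖ ^ 2 := by
  obtain ⟨ρ, hρ, hρ0, hρ1, -, -, hρs, -⟩ := exists_cutoff
  have hρc := hρ.continuous
  have hρd : Continuous (deriv ρ) := hρ.continuous_deriv (by simp)
  have hsq : HasCompactSupport fun t => ρ t ^ 2 := hρs.mono fun t ht h => ht (by simp [h])
  set A : ℝ := ∫ t, ρ t ^ 2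
  set B : ℝ := ∫ t, deriv ρ t ^ 2
  have hA : 0 < A := by
    refine Continuous.integral_pos_of_hasCompactSupport_nonneg_nonzero (x := 0) (hρc.pow 2) hsq
      (fun t => sq_nonneg _) ?_
    simp [hρ1]
  have hB : 0 ≤ B := integral_nonneg fun t => sq_nonneg _
  obtain ⟨x, hx0, hx⟩ : ∃ x > 0, x ^ 2 * B ≤ δ * A := by
    refine ⟨√(δ * A / (B + 1)), Real.sqrt_pos.2 (by positivity), ?_⟩
    rw [Real.sq_sqrt (by positivity), div_mul_eq_mul_div]
    exact div_le_of_le_mul₀ (by positivity) (by positivity) (by nlinarith [mul_pos hδ hA])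
  set a : ℝ := R + 2 / x
  have hsub : ∀ f : ℝ → ℝ, ∫ s, f (x * (s - a)) = x⁻¹ * ∫ t, f t := fun f => by
    rw [integral_sub_right_eq_self (fun s => f (x * s)) a, Measure.integral_comp_mul_left]
    simp [abs_of_pos hx0]
  set e : ℝ → ℂ := fun s => Complex.exp (Complex.I * k * s)
  have he : ∀ s, ‖e s‖ = 1 := fun s => by
    simp only [e]
    rw [show Complex.I * k * s = ((k * s : ℝ) : ℂ) * Complex.I by push_cast; ring,
      Complex.norm_exp_ofReal_mul_I]
  have hes : ContDiff ℝ ∞ e := (contDiff_const.mul Complex.ofRealCLM.contDiff).cexp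
  have hzero : ∀ s, 2 / x ≤ |s - a| → ρ (x * (s - a)) = 0 := fun s hs => by
    refine hρ0 _ ?_
    rw [abs_mul, abs_of_pos hx0]
    rwa [div_le_iff₀' hx0] at hs
  set χ : ℝ → ℂ := fun s => (ρ (x * (s - a)) : ℂ) * e s
  set τ : ℝ → ℂ := fun s => ((x * deriv ρ (x * (s - a)) : ℝ) : ℂ) * e s
  have hχ : ContDiff ℝ ∞ χ :=
    (Complex.ofRealCLM.contDiff.comp (hρ.comp (by fun_prop))).mul hes
  have hder : ∀ s, deriv χ s = Complex.I * k * χ s + τ s := fun s => by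
    have h1 : HasDerivAt (fun s => ρ (x * (s - a))) (deriv ρ (x * (s - a)) * x) s := by
      have h0 : HasDerivAt (fun s => x * (s - a)) x s := by
        simpa using ((hasDerivAt_id s).sub_const a).const_mul x
      exact ((hρ.differentiable (by simp) (x * (s - a))).hasDerivAt).comp s h0
    have h2 : HasDerivAt e (e s * (Complex.I * k * 1)) s :=
      ((Complex.ofRealCLM.hasDerivAt (x := s)).const_mul (Complex.I * k)).cexp
    have h3 : HasDerivAt χ _ s := h1.ofReal_comp.mul h2
    rw [h3.deriv]
    simp only [χ, τ]
    push_cast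
    ring
  have hcs : HasCompactSupport χ := by
    refine HasCompactSupport.intro (isCompact_Icc (a := a - 2 / x) (b := a + 2 / x)) fun s hs => ?_
    simp only [χ]
    rw [hzero s, Complex.ofReal_zero, zero_mul]
    by_contra h
    have := abs_le.1 (not_le.1 h).le
    exact hs ⟨by linarith, by linarith⟩
  have hτ : τ = fun s => deriv χ s - Complex.I * k * χ s := funext fun s => by rw [hder]; ring
  have hχ2 : ∫ s, ‖χ s‖ ^ 2 = x⁻¹ * A := by
    rw [← hsub]
    refine integral_congr_ae (Filter.Eventually.of_forall fun s => ?_)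
    simp only [χ, norm_mul, he, mul_one, Complex.norm_real, Real.norm_eq_abs, sq_abs]
  have hτ2 : ∫ s, ‖τ s‖ ^ 2 = x⁻¹ * (x ^ 2 * B) := by
    rw [← integral_const_mul, ← hsub]
    refine integral_congr_ae (Filter.Eventually.of_forall fun s => ?_)
    simp only [τ, norm_mul, he, mul_one, Complex.norm_real, Real.norm_eq_abs]
    rw [← abs_mul, sq_abs, mul_pow]
  refine ⟨χ, τ, hχ, hcs, ?_, ?_, fun s hs => ?_, hder, ?_, ?_⟩
  · rw [hτ]
    exact (hχ.continuous_deriv (by simp)).sub (continuous_const.mul hχ.continuous)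
  · rw [hτ]
    exact hcs.deriv.sub hcs.mul_left
  · simp only [χ]
    rw [hzero s, Complex.ofReal_zero, zero_mul]
    rw [abs_sub_comm]
    exact le_trans (by simp only [a]; linarith) (le_abs_self _)
  · rw [hχ2]
    positivity
  · rw [hχ2, hτ2, mul_left_comm δ]
    exact mul_le_mul_of_nonneg_left hx (by positivity)

end LeakyWire

/-! ### Products of functions of one coordinate -/

namespace LeakyWire

open scoped ENNReal

theorem planePt_coords (z : Plane) : planePt (z 0) (z 1) = z := by
  ext i
  fin_cases i <;> rfl

theorem hasDerivAt_planePt_fst {φ : Plane → ℂ} (hφ : Differentiable ℝ φ) (s t : ℝ) :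
    HasDerivAt (fun s => φ (planePt s t)) (partialDeriv 0 φ (planePt s t)) s := by
  have h1 : HasDerivAt (fun s => planePt s t) (EuclideanSpace.single 0 1) s := by
    simp only [planePt_eq]
    simpa using ((hasDerivAt_id s).smul_const (EuclideanSpace.single (0 : Fin 2) (1 : ℝ))).add_const
      (t • EuclideanSpace.single 1 1)
  exact (hφ _).hasFDerivAt.comp_hasDerivAt s h1

/-- The product of a function of the first and a function of the second coordinate. -/
def coordProd (a b : ℝ → ℂ) (z : Plane) : ℂ := a (z 0) * b (z 1)

theorem continuous_coordProd {a b : ℝ → ℂ} (ha : Continuous a) (hb : Continuous b) :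
    Continuous (coordProd a b) := by
  unfold coordProd
  fun_prop

theorem hasCompactSupport_coordProd {a b : ℝ → ℂ} (ha : HasCompactSupport a)
    (hb : HasCompactSupport b) : HasCompactSupport (coordProd a b) := by
  refine HasCompactSupport.intro
    ((IsCompact.prod (s := tsupport a) (t := tsupport b) ha hb).image continuous_planePt)
    fun z hz => ?_
  by_contra h
  refine hz ⟨(z 0, z 1), ⟨subset_tsupport a fun h0 => h ?_, subset_tsupport b fun h0 => h ?_⟩,
    planePt_coords z⟩
  · rw [coordProd, show a (z 0) = 0 from h0, zero_mul]
  · rw [coordProd, show b (z 1) = 0 from h0, mul_zero]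

theorem isTestFunction_coordProd {a b : ℝ → ℂ} (ha : ContDiff ℝ ∞ a) (has : HasCompactSupport a)
    (hb : ContDiff ℝ ∞ b) (hbs : HasCompactSupport b) : IsTestFunction (coordProd a b) := by
  refine ⟨?_, hasCompactSupport_coordProd has hbs⟩
  have h : ∀ i : Fin 2, ContDiff ℝ ∞ fun z : Plane => z i := fun i =>
    (EuclideanSpace.proj (𝕜 := ℝ) i).contDiff
  exact (ha.comp (h 0)).mul (hb.comp (h 1))

theorem partialDeriv_zero_coordProd {a b : ℝ → ℂ} (h : IsTestFunction (coordProd a b))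
    (ha : Differentiable ℝ a) : partialDeriv 0 (coordProd a b) = coordProd (deriv a) b := by
  funext z
  have h1 := hasDerivAt_planePt_fst (h.1.differentiable (by simp)) (z 0) (z 1)
  rw [planePt_coords] at h1
  exact h1.unique ((ha (z 0)).hasDerivAt.mul_const (b (z 1)))

theorem partialDeriv_one_coordProd {a b : ℝ → ℂ} (h : IsTestFunction (coordProd a b))
    (hb : Differentiable ℝ b) : partialDeriv 1 (coordProd a b) = coordProd a (deriv b) := by
  funext z
  have h1 := hasDerivAt_planePt_snd (h.1.differentiable (by simp)) (z 0) (z 1)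
  rw [planePt_coords] at h1
  exact h1.unique ((hb (z 1)).hasDerivAt.const_mul (a (z 0)))

theorem norm_sq_eq_of_coordProd {a b : ℝ → ℂ} (ha : Continuous a) (has : HasCompactSupport a)
    (hb : Continuous b) (hbs : HasCompactSupport b) {u : L2} (hu : u =ᵐ[volume] coordProd a b) :
    ‖u‖ ^ 2 = (∫ s, ‖a s‖ ^ 2) * ∫ t, ‖b t‖ ^ 2 := by
  have h1 := enorm_sq_eq_lintegral hu
  have hma : Measurable fun s => ‖a s‖ₑ ^ 2 := ha.measurable.enorm.pow_const 2
  have hmb : Measurable fun s => ‖b s‖ₑ ^ 2 := hb.measurable.enorm.pow_const 2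
  rw [lintegral_plane ((continuous_coordProd ha hb).measurable.enorm.pow_const 2)] at h1
  have h2 : ∀ s t, ‖coordProd a b (planePt s t)‖ₑ ^ 2 = ‖a s‖ₑ ^ 2 * ‖b t‖ₑ ^ 2 := fun s t => by
    rw [← mul_pow, ← enorm_mul]
    rfl
  simp only [h2] at h1
  simp only [lintegral_const_mul _ hmb] at h1
  rw [lintegral_mul_const _ hma, lintegral_enorm_sq_eq ha has, lintegral_enorm_sq_eq hb hbs,
    ← ENNReal.ofReal_mul (by positivity)] at h1
  exact (ENNReal.ofReal_eq_ofReal_iff (by positivity) (by positivity)).1 h1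

theorem norm_sq_trace_eq_of_coordProd {a b : ℝ → ℂ} (ha : Continuous a) (has : HasCompactSupport a)
    (hb : Continuous b) {u : Lp ℂ 2 (arcMeasure straightLine)}
    (hu : u =ᵐ[arcMeasure straightLine] coordProd a b) :
    ‖u‖ ^ 2 = (∫ s, ‖a s‖ ^ 2) * ‖b 0‖ ^ 2 := by
  have h1 := enorm_sq_eq_lintegral hu
  have hma : Measurable fun s => ‖a s‖ₑ ^ 2 := ha.measurable.enorm.pow_const 2
  rw [lintegral_arcMeasure_straightLine
    ((continuous_coordProd ha hb).measurable.enorm.pow_const 2)] at h1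
  have h2 : ∀ s, ‖coordProd a b (planePt s 0)‖ₑ ^ 2 = ‖a s‖ₑ ^ 2 * ‖b 0‖ₑ ^ 2 := fun s => by
    rw [← mul_pow, ← enorm_mul]
    rfl
  simp only [h2] at h1
  rw [lintegral_mul_const _ hma, lintegral_enorm_sq_eq ha has, ← ofReal_norm,
    ← ENNReal.ofReal_pow (norm_nonneg _), ← ENNReal.ofReal_mul (by positivity)] at h1
  exact (ENNReal.ofReal_eq_ofReal_iff (by positivity) (by positivity)).1 h1

/-! ### Weyl sequences -/

theorem inner_grad_eq_neg_inner {η : Measure Plane} {p q : L2 × (Fin 2 → L2) × Lp ℂ 2 η}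
    (hp : p ∈ restrictionGraph η) (hq : q ∈ restrictionGraph η) (i : Fin 2) :
    ⟪q.2.1 i, p.1⟫_ℂ = -⟪q.1, p.2.1 i⟫_ℂ := by
  obtain ⟨φ, hφ, h1, h2, -⟩ := hp
  obtain ⟨ψ, hψ, k1, k2, -⟩ := hq
  have hψ' : IsTestFunction (star ψ) :=
    ⟨Complex.conjCLE.contDiff.comp hψ.1, hψ.2.comp_left (g := star) (star_zero ℂ)⟩
  have hd : ∀ x, partialDeriv i (star ψ) x = star (partialDeriv i ψ x) := fun x => by
    have := Complex.conjCLE.toContinuousLinearMap.hasFDerivAt.comp x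
      (hψ.1.differentiable (by simp) x).hasFDerivAt
    exact congrArg (fun L => L (EuclideanSpace.single i 1)) this.fderiv
  have h := hφ.hasWeakGradient h1 h2 i (star ψ) hψ'
  rw [L2.inner_def, L2.inner_def]
  refine Eq.trans (integral_congr_ae ?_) (h.trans (congrArg Neg.neg (integral_congr_ae ?_)))
  · filter_upwards [k2 i] with x hx
    rw [hx, RCLike.inner_apply, hd]
    rfl
  · filter_upwards [k1] with x hx
    rw [hx, RCLike.inner_apply]
    rfl

/-- The part of the form of the straight line that acts in the normal direction, shifted by the
bottom `-α² / 4` of its spectrum. -/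
noncomputable def normalForm (α : ℝ) {η : Measure Plane} (q p : L2 × (Fin 2 → L2) × Lp ℂ 2 η) : ℂ :=
  ⟪q.2.1 1, p.2.1 1⟫_ℂ + ((α ^ 2 / 4 : ℝ) : ℂ) * ⟪q.1, p.1⟫_ℂ - (α : ℂ) * ⟪q.2.2, p.2.2⟫_ℂ

theorem re_normalForm_self (α : ℝ) {η : Measure Plane} (p : L2 × (Fin 2 → L2) × Lp ℂ 2 η) :
    (normalForm α p p).re = ‖p.2.1 1‖ ^ 2 + α ^ 2 / 4 * ‖p.1‖ ^ 2 - α * ‖p.2.2‖ ^ 2 := by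
  simp only [normalForm, inner_self_eq_norm_sq_to_K]
  rw [Complex.sub_re, Complex.add_re, Complex.re_ofReal_mul, Complex.re_ofReal_mul]
  simp only [← Complex.ofReal_pow, Complex.coe_algebraMap, Complex.ofReal_re]

theorem re_normalForm_self_nonneg {α : ℝ} (hα : 0 < α)
    {p : L2 × (Fin 2 → L2) × Lp ℂ 2 (arcMeasure straightLine)}
    (hp : p ∈ restrictionGraph (arcMeasure straightLine)) : 0 ≤ (normalForm α p p).re := by
  obtain ⟨φ, hφ, h1, h2, h3⟩ := hp
  have h := mul_lintegral_straightLine_le hφ hα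
  rw [← enorm_sq_eq_lintegral h1, ← enorm_sq_eq_lintegral (h2 1), ← enorm_sq_eq_lintegral h3,
    ← ENNReal.ofReal_mul hα.le, ← ENNReal.ofReal_mul (by positivity),
    ← ENNReal.ofReal_add (by positivity) (by positivity),
    ENNReal.ofReal_le_ofReal_iff (by positivity)] at h
  rw [re_normalForm_self]
  linarith

/-- The Cauchy–Schwarz inequality for the normal form on the straight line, which is positive by
the sharp trace inequality. -/
theorem norm_normalForm_sq_le {α : ℝ} (hα : 0 < α)
    {q p : L2 × (Fin 2 → L2) × Lp ℂ 2 (arcMeasure straightLine)}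
    (hq : q ∈ restrictionGraph (arcMeasure straightLine))
    (hp : p ∈ restrictionGraph (arcMeasure straightLine)) :
    ‖normalForm α q p‖ ^ 2 ≤ (normalForm α q q).re * (normalForm α p p).re := by
  have hsymm : ∀ x y : L2 × (Fin 2 → L2) × Lp ℂ 2 (arcMeasure straightLine),
      starRingEnd ℂ (normalForm α y x) = normalForm α x y := fun x y => by
    simp only [normalForm, map_sub, map_add, map_mul, inner_conj_symm, Complex.conj_ofReal]
  let core : PreInnerProductSpace.Core ℂ (restrictionGraph (arcMeasure straightLine)) :=
    { inner := fun x y => normalForm α x.1 y.1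
      conj_inner_symm := fun x y => hsymm x.1 y.1
      re_inner_nonneg := fun x => re_normalForm_self_nonneg hα x.2
      add_left := fun x y z => by
        simp only [normalForm, Submodule.coe_add, Prod.fst_add, Prod.snd_add, Pi.add_apply,
          inner_add_left]
        ring
      smul_left := fun x y c => by
        simp only [normalForm, Submodule.coe_smul, Prod.smul_fst, Prod.smul_snd, Pi.smul_apply,
          inner_smul_left]
        ring }
  have h1 := InnerProductSpace.Core.inner_mul_inner_self_le (c := core) ⟨q, hq⟩ ⟨p, hp⟩
  have h2 : ‖normalForm α p q‖ = ‖normalForm α q p‖ := by rw [← hsymm, RCLike.norm_conj]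
  rw [sq]
  calc _ = ‖normalForm α q p‖ * ‖normalForm α p q‖ := by rw [h2]
    _ ≤ _ := h1

theorem IsCompactDeformation.integral_arcMeasure_eq {Γ : Set Plane} (hΓ : IsCompactDeformation Γ)
    {R : ℝ} (hR : Γ \ Metric.closedBall 0 R = straightLine \ Metric.closedBall 0 R) {f : Plane → ℂ}
    (hf : ∀ x ∈ Metric.closedBall 0 R, f x = 0) :
    ∫ x, f x ∂(arcMeasure Γ) = ∫ x, f x ∂(arcMeasure straightLine) := by
  have h : ∀ A : Set Plane, MeasurableSet A →
      ∫ x, f x ∂(arcMeasure A) = ∫ x in A \ Metric.closedBall 0 R, f x ∂μH[1] := fun A hA =>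
    setIntegral_eq_of_subset_of_forall_sdiff_eq_zero hA sdiff_subset fun x hx =>
      hf x (by_contra fun h => hx.2 ⟨hx.1, h⟩)
  rw [h Γ hΓ.measurableSet, hR, h _ isCompactDeformation_straightLine.measurableSet]

/-- Test functions on `Γ` supported off the deformation, compared with the straight line: the form
of `Γ` splits into its tangential part and the normal part, taken for the straight line. -/
theorem IsCompactDeformation.formValue_eq {Γ : Set Plane} (hΓ : IsCompactDeformation Γ)
    {R : ℝ} (hR : Γ \ Metric.closedBall 0 R = straightLine \ Metric.closedBall 0 R)
    {φ ψ : Plane → ℂ}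
    (hφ : ∀ x ∈ Metric.closedBall 0 R, φ x = 0) {p q : L2 × (Fin 2 → L2) × Lp ℂ 2 (arcMeasure Γ)}
    {p' q' : L2 × (Fin 2 → L2) × Lp ℂ 2 (arcMeasure straightLine)}
    (hp : p.2.2 =ᵐ[arcMeasure Γ] φ) (hp' : p'.2.2 =ᵐ[arcMeasure straightLine] φ)
    (hq : q.2.2 =ᵐ[arcMeasure Γ] ψ) (hq' : q'.2.2 =ᵐ[arcMeasure straightLine] ψ)
    (hp1 : p'.1 = p.1) (hp2 : p'.2.1 = p.2.1) (hq1 : q'.1 = q.1) (hq2 : q'.2.1 = q.2.1) (α k : ℝ) :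
    formValue α q.2.1 q.2.2 p.2.1 p.2.2 - ((k ^ 2 - α ^ 2 / 4 : ℝ) : ℂ) * ⟪q.1, p.1⟫_ℂ =
      (⟪q.2.1 0, p.2.1 0⟫_ℂ - (k : ℂ) ^ 2 * ⟪q.1, p.1⟫_ℂ) + normalForm α q' p' := by
  have h : ⟪q.2.2, p.2.2⟫_ℂ = ⟪q'.2.2, p'.2.2⟫_ℂ := by
    rw [L2.inner_def, L2.inner_def]
    have e1 : ∫ x, ⟪q.2.2 x, p.2.2 x⟫_ℂ ∂(arcMeasure Γ) = ∫ x, ⟪ψ x, φ x⟫_ℂ ∂(arcMeasure Γ) := by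
      refine integral_congr_ae ?_
      filter_upwards [hp, hq] with x h1 h2
      rw [h1, h2]
    have e2 : ∫ x, ⟪q'.2.2 x, p'.2.2 x⟫_ℂ ∂(arcMeasure straightLine) =
        ∫ x, ⟪ψ x, φ x⟫_ℂ ∂(arcMeasure straightLine) := by
      refine integral_congr_ae ?_
      filter_upwards [hp', hq'] with x h1 h2
      rw [h1, h2]
    rw [e1, e2]
    exact hΓ.integral_arcMeasure_eq hR fun x hx => by rw [hφ x hx, inner_zero_right]
  rw [formValue, normalForm, Fin.sum_univ_two, h, hp1, hp2, hq1, hq2]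
  push_cast
  ring

/-- Far from the deformation the functions `χ(x₁) w(x₂)`, with `χ` a slowly modulated plane wave
and `w` a profile that almost saturates the normal trace inequality, are approximate
eigenfunctions. -/
theorem IsCompactDeformation.hasWeylSequences {Γ : Set Plane} (hΓ : IsCompactDeformation Γ) {α : ℝ}
    (hα : 0 < α) : HasWeylSequences α (arcMeasure Γ) := by
  intro t ht ε hε
  have := hΓ.isFiniteMeasureOnCompacts
  have := isCompactDeformation_straightLine.isFiniteMeasureOnCompacts
  obtain ⟨R, -, hR⟩ := hΓ.exists_closedBall
  set k : ℝ := √(t + α ^ 2 / 4)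
  have hk : 0 ≤ k := Real.sqrt_nonneg _
  have hk2 : k ^ 2 = t + α ^ 2 / 4 := Real.sq_sqrt (by linarith)
  set d : ℝ := ε / (1 + k + α / 2)
  have hd : 0 < d := by positivity
  obtain ⟨w, hw, hws, hw0, hwi⟩ := exists_profile (κ := α / 2) (δ := d ^ 2) (by positivity)
    (by positivity)
  obtain ⟨χ, τ, hχ, hχs, hτ, hτs, hχ0, hχd, hχp, hχτ⟩ := exists_modulated_wave k R
    (δ := d ^ 2) (by positivity)
  have hφ : IsTestFunction (coordProd χ w) := isTestFunction_coordProd hχ hχs hw hws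
  have hφ0 : ∀ x ∈ Metric.closedBall 0 R, coordProd χ w x = 0 := fun x hx => by
    have h1 : x 0 ≤ R := by
      refine (le_abs_self _).trans (((PiLp.norm_apply_le x 0)).trans ?_)
      simpa using hx
    rw [coordProd, hχ0 _ h1, zero_mul]
  have hd0 := partialDeriv_zero_coordProd hφ (hχ.differentiable (by simp))
  have hd1 := partialDeriv_one_coordProd hφ (hw.differentiable (by simp))
  obtain ⟨p, hp, hp1, hp2, hp3⟩ := hφ.exists_mem_restrictionGraph (arcMeasure Γ)
  obtain ⟨p', hp', hp1', hp2', hp3'⟩ := hφ.exists_mem_restrictionGraph (arcMeasure straightLine)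
  have hpp1 : p'.1 = p.1 := Lp.ext (hp1'.trans hp1.symm)
  have hpp2 : p'.2.1 = p.2.1 := funext fun i => Lp.ext ((hp2' i).trans (hp2 i).symm)
  have hτm : MemLp (coordProd τ w) 2 (volume : Measure Plane) :=
    (continuous_coordProd hτ hw.continuous).memLp_of_hasCompactSupport
      (hasCompactSupport_coordProd hτs hws)
  set r : L2 := hτm.toLp
  have hr : r =ᵐ[volume] coordProd τ w := hτm.coeFn_toLp
  have hn := norm_sq_eq_of_coordProd hχ.continuous hχs hw.continuous hws hp1
  have hnr := norm_sq_eq_of_coordProd hτ hτs hw.continuous hws hr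
  have hn1 := norm_sq_eq_of_coordProd hχ.continuous hχs (hw.continuous_deriv (by simp)) hws.deriv
    (u := p'.2.1 1) ((hp2' 1).trans (by rw [hd1]))
  have hnt := norm_sq_trace_eq_of_coordProd hχ.continuous hχs hw.continuous hp3'
  have hrp : ‖r‖ ≤ d * ‖p.1‖ := by
    refine le_of_sq_le_sq ?_ (by positivity)
    rw [mul_pow, hn, hnr, ← mul_assoc]
    gcongr
  have hN : (normalForm α p' p').re ≤ (d * ‖p.1‖) ^ 2 := by
    rw [re_normalForm_self, hn1, hnt, hpp1, mul_pow, hn]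
    have := mul_le_mul_of_nonneg_left hwi hχp.le
    nlinarith
  have hgrad : p.2.1 0 = (Complex.I * k) • p.1 + r := by
    refine Lp.ext ?_
    filter_upwards [hp2 0, hp1, hr, Lp.coeFn_add ((Complex.I * k) • p.1) r,
      Lp.coeFn_smul (Complex.I * k) p.1] with x h1 h2 h3 h4 h5
    rw [h4, Pi.add_apply, h5, Pi.smul_apply, h1, h2, h3, hd0]
    simp only [coordProd, hχd, smul_eq_mul]
    ring
  refine ⟨p, hp, fun h => ?_, fun q hq => ?_⟩
  · rw [h, norm_zero] at hn
    have : 0 < (∫ s, ‖χ s‖ ^ 2) * ∫ t, ‖w t‖ ^ 2 := by positivity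
    linarith
  obtain ⟨ψ, hψ, hq1, hq2, hq3⟩ := id hq
  obtain ⟨q', hq', hq1', hq2', hq3'⟩ := hψ.exists_mem_restrictionGraph (arcMeasure straightLine)
  have hqq1 : q'.1 = q.1 := Lp.ext (hq1'.trans hq1.symm)
  have hqq2 : q'.2.1 = q.2.1 := funext fun i => Lp.ext ((hq2' i).trans (hq2 i).symm)
  have hsplit := hΓ.formValue_eq hR hφ0 hp3 hp3' hq3 hq3' hpp1 hpp2 hqq1 hqq2 α k
  rw [hk2, add_sub_cancel_right] at hsplit
  -- The tangential part, after an integration by parts, involves only the modulation error `r`.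
  have htan : ⟪q.2.1 0, p.2.1 0⟫_ℂ - (k : ℂ) ^ 2 * ⟪q.1, p.1⟫_ℂ =
      ⟪q.2.1 0, r⟫_ℂ - Complex.I * k * ⟪q.1, r⟫_ℂ := by
    have h1 := inner_grad_eq_neg_inner hp hq 0
    rw [hgrad, inner_add_right, inner_smul_right] at h1
    rw [hgrad, inner_add_right, inner_smul_right, h1]
    linear_combination (-(k : ℂ) ^ 2 * ⟪q.1, p.1⟫_ℂ) * Complex.I_sq
  have b1 : ‖⟪q.2.1 0, r⟫_ℂ - Complex.I * k * ⟪q.1, r⟫_ℂ‖ ≤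
      ‖q.2.1 0‖ * (d * ‖p.1‖) + k * (‖q.1‖ * (d * ‖p.1‖)) := by
    refine (norm_sub_le _ _).trans (add_le_add ((norm_inner_le_norm _ _).trans (by gcongr)) ?_)
    rw [norm_mul, norm_mul, Complex.norm_I, one_mul, Complex.norm_real, Real.norm_of_nonneg hk]
    gcongr
    exact (norm_inner_le_norm _ _).trans (by gcongr)
  have b2 : ‖normalForm α q' p'‖ ≤ (‖q.2.1 1‖ + α / 2 * ‖q.1‖) * (d * ‖p.1‖) := by
    refine le_of_sq_le_sq ?_ (by positivity)
    have h1 : (normalForm α q' q').re ≤ (‖q.2.1 1‖ + α / 2 * ‖q.1‖) ^ 2 := by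
      rw [re_normalForm_self, hqq1, hqq2]
      have h2 : 0 ≤ α * ‖q'.2.2‖ ^ 2 := by positivity
      have h3 : 0 ≤ α * (‖q.2.1 1‖ * ‖q.1‖) := by positivity
      linarith
    rw [mul_pow]
    exact (norm_normalForm_sq_le hα hq' hp').trans
      (mul_le_mul h1 hN (re_normalForm_self_nonneg hα hp') (sq_nonneg _))
  rw [hsplit, htan, Fin.sum_univ_two]
  have hdε : ε = d * (1 + k + α / 2) := by
    simp only [d]
    field_simp
  refine (norm_add_le _ _).trans ((add_le_add b1 b2).trans ?_)
  rw [hdε, ← sub_nonneg]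
  have hdp : 0 ≤ d * ‖p.1‖ := by positivity
  have h0 : 0 ≤ d * ‖p.1‖ * (‖q.1‖ + (k + α / 2) * (‖q.2.1 0‖ + ‖q.2.1 1‖) +
      (1 + k + α / 2) * ‖q.2.2‖) := by positivity
  refine h0.trans_eq ?_
  ring

end LeakyWire

theorem mainTheorem2 (α : ℝ) (hα : 0 < α) (Γ : Set LeakyWire.Plane)
    (hΓ : LeakyWire.IsCompactDeformation Γ) :
    IsSelfAdjoint (LeakyWire.hamiltonian α Γ) ∧
    IsSelfAdjoint (LeakyWire.hamiltonian α LeakyWire.straightLine) ∧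
    LeakyWire.essentialSpectrum (LeakyWire.hamiltonian α Γ) =
      LeakyWire.essentialSpectrum (LeakyWire.hamiltonian α LeakyWire.straightLine) ∧
    LeakyWire.essentialSpectrum (LeakyWire.hamiltonian α LeakyWire.straightLine) =
      (fun t : ℝ => (t : ℂ)) '' Set.Ici (-(1 / 4) * α ^ 2) := by
  have h : ∀ A : Set LeakyWire.Plane, LeakyWire.IsCompactDeformation A →
      IsSelfAdjoint (LeakyWire.hamiltonian α A) ∧
      LeakyWire.essentialSpectrum (LeakyWire.hamiltonian α A) =
        (fun t : ℝ => (t : ℂ)) '' Set.Ici (-(1 / 4) * α ^ 2) := fun A hA =>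
    have := hA.isFiniteMeasureOnCompacts
    LeakyWire.isSelfAdjoint_and_essentialSpectrum_eq hA.hasTraceBound hα (hA.hasWeylSequences hα)
  obtain ⟨h1, h2⟩ := h Γ hΓ
  obtain ⟨h3, h4⟩ := h _ LeakyWire.isCompactDeformation_straightLine
  exact ⟨h1, h3, h2.trans h4.symm, h4⟩
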